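/- All rings are commutative with unity, and all monoids are commutative, cancellative and torsion-free ($x^n=y^n$ with $n\ge 1$ implies $x=y$). A monoid is positive if its only unit is the identity. For a ring extension $A\subset B$, let $\mathcal I(A,B)$ be the multiplicative group of invertible $A$-submodules of $B$; a ring homomorphism $f:B\to B'$ with $f(A)\subset A'$ induces the group homomorphism $\mathcal I(f):\mathcal I(A,B)\to\mathcal I(A',B')$, $I\mapsto A'f(I)$. For a monoid $M$ let $\theta(A,B):\mathcal I(A,B)\to\mathcal I(A[M],B[M])$ be the homomorphism induced by the inclusion $B\subset B[M]$. An extension $D\subset E$ of rings is elementary subintegral if $E=D[b]$ for some $b$ with $b^2,b^3\in D$; an extension $A\subset C$ is subintegral if $C$ is a union of subrings each obtained from $A$ by a finite succession of elementary subintegral extensions. The subintegral closure of $A$ in $B$ is the largest subring of $B$ containing $A$ that is subintegral over $A$. **Theorem 1.4.** Let $A\subset B$ be an extension of rings, let ${}^+\!A$ be the subintegral closure of $A$ in $B$, and let $M$ be a positive monoid. (i) The diagram $$\begin{array}{ccccccccc} 1&\to&\mathcal I(A,{}^+\!A)&\to&\mathcal I(A,B)&\to&\mathcal I({}^+\!A,B)&\to&1\\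 &&\downarrow{\scriptstyle\theta(A,{}^+\!A)}&&\downarrow{\scriptstyle\theta(A,B)}&&\downarrow{\scriptstyle\theta({}^+\!A,B)}&&\\ 1&\to&\mathcal I(A[M],{}^+\!A[M])&\to&\mathcal I(A[M],B[M])&\to&\mathcal I({}^+\!A[M],B[M])&\to&1 \end{array}$$ is commutative with exact rows, and $\theta({}^+\!A,B)$ is an isomorphism. Here the left horizontal maps are induced by the inclusions ${}^+\!A\subset B$ and ${}^+\!A[M]\subset B[M]$, and the right horizontal maps by the identity maps of $B$ and $B[M]$ (that is, $I\mapsto {}^+\!A\,I$ and $I\mapsto {}^+\!A[M]\,I$). (ii) If $\mathbb Q\subset A$, then there is an isomorphism of abelian groups $\mathcal I(A[M],{}^+\!A[M])\cong\mathbb Z[M]\otimes_{\mathbb Z}\mathcal I(A,{}^+\!A)$. -/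

import Mathlib

open scoped TensorProduct
-- For an `A`-algebra `B`, this makes `B[M]` an algebra over `A[M]` by applying `A → B` coefficientwise.
open scoped AlgebraMonoidAlgebra

universe u v w

namespace InvMod

/-! ### Subintegral closure

A ring extension `A ⊂ B` is an `A`-algebra `B` with injective structure map, and the rings between
`A` and `B` are the `A`-subalgebras of `B`; `⊥` is (the image of) `A` itself. -/

section Subintegral

variable {A : Type u} {B : Type v} [CommRing A] [CommRing B] [Algebra A B]

/-- `D ⊂ E` is elementary subintegral: `E = D[b]` for some `b` with `b ^ 2, b ^ 3 ∈ D`. -/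
def IsElementarySubintegral (D E : Subalgebra A B) : Prop :=
  ∃ b : B, b ^ 2 ∈ D ∧ b ^ 3 ∈ D ∧ E = D ⊔ Algebra.adjoin A {b}

/-- `D` is obtained from `A` by a finite succession of elementary subintegral extensions. -/
def IsFiniteSubintegral (D : Subalgebra A B) : Prop :=
  Relation.ReflTransGen IsElementarySubintegral ⊥ D

/-- `A ⊂ C` is subintegral: `C` is a union of subrings each of which is obtained from `A` by a
finite succession of elementary subintegral extensions. -/
def IsSubintegral (C : Subalgebra A B) : Prop :=
  ∃ S : Set (Subalgebra A B), (∀ D ∈ S, IsFiniteSubintegral D) ∧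
    (C : Set B) = ⋃ D ∈ S, (D : Set B)

theorem IsFiniteSubintegral.sup {D E : Subalgebra A B} (hD : IsFiniteSubintegral D)
    (hE : IsFiniteSubintegral E) : IsFiniteSubintegral (D ⊔ E) := by
  unfold IsFiniteSubintegral at hE
  induction hE with
  | refl => simpa using hD
  | @tail E F _ hEF ih =>
    obtain ⟨b, h2, h3, rfl⟩ := hEF
    refine Relation.ReflTransGen.tail ih ⟨b, ?_, ?_, ?_⟩
    · exact (le_sup_right : E ≤ D ⊔ E) h2
    · exact (le_sup_right : E ≤ D ⊔ E) h3
    · rw [sup_assoc]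

variable (A B) in
/-- The subintegral closure `⁺A` of `A` in `B`: the largest subintegral extension of `A` in `B`
(see `isGreatest_subintegralClosure`), namely the union of all subrings of `B` obtained from `A` by
a finite succession of elementary subintegral extensions. -/
def subintegralClosure : Subalgebra A B where
  carrier := {b | ∃ D : Subalgebra A B, IsFiniteSubintegral D ∧ b ∈ D}
  mul_mem' := by
    rintro a b ⟨D, hD, ha⟩ ⟨E, hE, hb⟩
    exact ⟨D ⊔ E, hD.sup hE, mul_mem ((le_sup_left : D ≤ D ⊔ E) ha)
      ((le_sup_right : E ≤ D ⊔ E) hb)⟩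
  add_mem' := by
    rintro a b ⟨D, hD, ha⟩ ⟨E, hE, hb⟩
    exact ⟨D ⊔ E, hD.sup hE, add_mem ((le_sup_left : D ≤ D ⊔ E) ha)
      ((le_sup_right : E ≤ D ⊔ E) hb)⟩
  algebraMap_mem' := fun a => ⟨⊥, Relation.ReflTransGen.refl, Subalgebra.algebraMap_mem _ a⟩

variable (A B) in
theorem isGreatest_subintegralClosure :
    IsGreatest {C : Subalgebra A B | IsSubintegral C} (subintegralClosure A B) := by
  constructor
  · refine ⟨{D | IsFiniteSubintegral D}, fun D hD => hD, ?_⟩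
    ext b
    simp [subintegralClosure]
  · rintro C ⟨S, hS, hC⟩ b hb
    have hb' : b ∈ ⋃ D ∈ S, (D : Set B) := hC ▸ hb
    simp only [Set.mem_iUnion] at hb'
    obtain ⟨D, hD, hbD⟩ := hb'
    exact ⟨D, hS D hD, hbD⟩

end Subintegral

/-! ### The functor of invertible submodules -/

/-- The multiplicative group `𝓘(A, B)` of invertible `A`-submodules of `B`. -/
abbrev Inv (A : Type u) (B : Type v) [CommRing A] [CommRing B] [Algebra A B] : Type v :=
  (Submodule A B)ˣ

section Functor

variable {A : Type*} {B : Type*} [CommRing A] [CommRing B] [Algebra A B]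
  {A' : Type*} {B' : Type*} [CommRing A'] [CommRing B'] [Algebra A' B']

/-- `f : B → B'` is a morphism of ring extensions `(A, B) → (A', B')`, that is, `f(A) ⊂ A'`. -/
def IsPairHom (A : Type*) {B : Type*} [CommRing A] [CommRing B] [Algebra A B]
    (A' : Type*) {B' : Type*} [CommRing A'] [CommRing B'] [Algebra A' B'] (f : B →+* B') : Prop :=
  ∀ a : A, f (algebraMap A B a) ∈ (algebraMap A' B').range

/-- The image of an `A`-submodule of `B` under a morphism of ring extensions:
`I ↦ A' f(I)`, the `A'`-submodule of `B'` generated by `f(I)`. -/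
def extend (f : B →+* B') (hf : IsPairHom A A' f) : Submodule A B →* Submodule A' B' where
  toFun I := Submodule.span A' (f '' (I : Set B))
  map_one' := by
    apply le_antisymm
    · rw [Submodule.span_le]
      rintro _ ⟨x, hx, rfl⟩
      obtain ⟨a, rfl⟩ := Submodule.mem_one.mp hx
      obtain ⟨a', ha'⟩ := hf a
      exact Submodule.mem_one.mpr ⟨a', ha'⟩
    · rw [Submodule.one_le]
      exact Submodule.subset_span ⟨1, Submodule.one_le.mp le_rfl, map_one f⟩
  map_mul' I J := by
    rw [Submodule.span_mul_span]
    apply le_antisymm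
    · rw [Submodule.span_le]
      rintro _ ⟨x, hx, rfl⟩
      induction hx using Submodule.mul_induction_on' with
      | mem_mul_mem m hm n hn =>
        rw [map_mul]
        exact Submodule.subset_span (Set.mul_mem_mul ⟨m, hm, rfl⟩ ⟨n, hn, rfl⟩)
      | add x _ y _ hx hy =>
        rw [map_add]
        exact add_mem hx hy
    · apply Submodule.span_mono
      rintro _ ⟨_, ⟨m, hm, rfl⟩, _, ⟨n, hn, rfl⟩, rfl⟩
      exact ⟨m * n, Submodule.mul_mem_mul hm hn, map_mul f m n⟩

/-- The group homomorphism `𝓘(f) : 𝓘(A, B) → 𝓘(A', B')` induced by a morphism `f` of ring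
extensions. -/
def Inv.map (f : B →+* B') (hf : IsPairHom A A' f) : Inv A B →* Inv A' B' :=
  Units.map (extend f hf)

end Functor

/-! ### The maps of the diagram -/

section Maps

variable (A : Type u) (B : Type v) [CommRing A] [CommRing B] [Algebra A B]
  (C : Subalgebra A B) (M : Type w) [CommMonoid M]

/-- `𝓘(A, C) → 𝓘(A, B)`, induced by the inclusion `C ⊂ B`. -/
def inclMap : Inv A C →* Inv A B :=
  Inv.map (C.val : C →+* B) fun a => ⟨a, rfl⟩

/-- `φ(A, C, B) : 𝓘(A, B) → 𝓘(C, B)`, induced by the identity of `B`, that is, `I ↦ C I`. -/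
def extMap : Inv A B →* Inv C B :=
  Inv.map (RingHom.id B) fun a => ⟨algebraMap A C a, rfl⟩

/-- `𝓘(A[M], C[M]) → 𝓘(A[M], B[M])`, induced by the inclusion `C[M] ⊂ B[M]`. -/
noncomputable def inclMapMonoid :
    Inv (MonoidAlgebra A M) (MonoidAlgebra C M) →* Inv (MonoidAlgebra A M) (MonoidAlgebra B M) :=
  Inv.map (MonoidAlgebra.mapRingHom M (C.val : C →+* B)) fun a => ⟨a, by
    ext m
    simp⟩

/-- `φ(A[M], C[M], B[M]) : 𝓘(A[M], B[M]) → 𝓘(C[M], B[M])`, induced by the identity of `B[M]`. -/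
noncomputable def extMapMonoid :
    Inv (MonoidAlgebra A M) (MonoidAlgebra B M) →* Inv (MonoidAlgebra C M) (MonoidAlgebra B M) :=
  Inv.map (RingHom.id (MonoidAlgebra B M)) fun a =>
    ⟨algebraMap (MonoidAlgebra A M) (MonoidAlgebra C M) a, by
      ext m
      simp⟩

/-- `θ(A, B) : 𝓘(A, B) → 𝓘(A[M], B[M])`, induced by the inclusion `B ⊂ B[M]`. -/
noncomputable def theta : Inv A B →* Inv (MonoidAlgebra A M) (MonoidAlgebra B M) :=
  Inv.map (MonoidAlgebra.singleOneRingHom : B →+* MonoidAlgebra B M) fun a =>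
    ⟨MonoidAlgebra.singleOneRingHom a, by simp⟩

end Maps

end InvMod

/-! Rows. Injectivity and exactness in the middle are formal: an invertible `J` that becomes trivial
over `S` lies in `S` together with its inverse. Surjectivity on the right is a descent statement.
Finitely many generators reduce it to one step `D ⊂ D[b]`. Invertible modules over `D[b]` with
generators `x i`, `y i` give the idempotent matrix `(y i * x j)`; its reduction modulo `b` can be
lifted to `D` because `b ^ 2 D[b] ⊂ D` (`IsElementarySubintegral.exists_descent`). The lower row is
the same statement, since `A[M] ⊂ ⁺A[M]` is again subintegral.

The isomorphism. As `M` is positive, the constant coefficient is a ring retraction `B[M] → B`, which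
gives a left inverse of `θ`. It remains to see that an invertible module whose constant part is
trivial is trivial, that is, that suitable generators have coefficients in `R = ⁺A`. Gordan's
theorem provides a substitution of powers of `X` for the finitely many monomials involved, so one
variable suffices. There Kronecker's theorem makes the coefficients integral, hence one may assume
`S` finite over `R`; the conductor is radical because `R` is subintegrally closed, and localizing
modulo the conductor at a minimal prime replaces `R` by a field `k`. Over `k` the claim holds
because `k[X]` is principal and units of `L[X]` are constant for reduced `L`
(`IsNormalizedSystem.coeff_mem`).

Part (ii). For a subintegral extension `A ⊂ C` of `ℚ`-algebras the map `b ↦ A exp(b)` is a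
surjection `C → 𝓘(A, C)` with kernel `A` (`expHom_surjective`, `ker_expHom`). The series `exp(b)`
has no meaning in `C`, so `A exp(b)` is built from polynomials `f` for which `exp(-bX) f` has
coefficients in `A`, a condition on iterates of `f ↦ f' - b f`, and then `X = 1` is substituted.
Applied to `A ⊂ C` and to `A[M] ⊂ C[M]`, this identifies `𝓘(A[M], C[M])` with `C[M]/A[M] = ℤ[M] ⊗
C/A`. -/

namespace InvMod

/-! ### Descent of invertible modules along subintegral extensions. -/

section Descent

variable {k : Type*} {Ω : Type*} [CommRing k] [CommRing Ω] [Algebra k Ω]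

theorem mul_mono_left {I J K : Submodule k Ω} (h : I ≤ J) : I * K ≤ J * K := mul_le_mul_left h K

theorem mul_mono_right {I J K : Submodule k Ω} (h : I ≤ J) : K * I ≤ K * J := mul_le_mul_right h K

theorem _root_.Submodule.exists_fin_sum_of_mem_mul {I J : Submodule k Ω} {z : Ω} (hz : z ∈ I * J) :
    ∃ (n : ℕ) (x y : Fin n → Ω), (∀ i, x i ∈ I) ∧ (∀ i, y i ∈ J) ∧ ∑ i, x i * y i = z := by
  induction hz using Submodule.mul_induction_on' with
  | mem_mul_mem m hm n hn =>
    exact ⟨1, fun _ => m, fun _ => n, fun _ => hm, fun _ => hn, by simp⟩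
  | add z₁ _ z₂ _ h₁ h₂ =>
    obtain ⟨n₁, x₁, y₁, hx₁, hy₁, rfl⟩ := h₁
    obtain ⟨n₂, x₂, y₂, hx₂, hy₂, rfl⟩ := h₂
    refine ⟨n₁ + n₂, Fin.append x₁ x₂, Fin.append y₁ y₂, ?_, ?_, ?_⟩
    · intro i
      induction i using Fin.addCases <;> simp [hx₁, hx₂]
    · intro i
      induction i using Fin.addCases <;> simp [hy₁, hy₂]
    · simp [Fin.sum_univ_add]

theorem mul_mem_of_sq_of_cube {D : Subalgebra k Ω} {b : Ω} (h2 : b ^ 2 ∈ D) (h3 : b ^ 3 ∈ D) {z : Ω}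
    (hz : ∃ p ∈ D, ∃ q ∈ D, z = p + b * q) : b ^ 2 * z ∈ D := by
  obtain ⟨p, hp, q, hq, rfl⟩ := hz
  rw [show b ^ 2 * (p + b * q) = b ^ 2 * p + b ^ 3 * q by ring]
  exact add_mem (mul_mem h2 hp) (mul_mem h3 hq)

theorem mem_sup_adjoin_iff {D : Subalgebra k Ω} {b : Ω} (h2 : b ^ 2 ∈ D) {z : Ω} :
    z ∈ D ⊔ Algebra.adjoin k {b} ↔ ∃ p ∈ D, ∃ q ∈ D, z = p + b * q := by
  constructor
  · intro hz
    let E : Subalgebra k Ω :=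
      { carrier := {z | ∃ p ∈ D, ∃ q ∈ D, z = p + b * q}
        mul_mem' := by
          rintro _ _ ⟨p, hp, q, hq, rfl⟩ ⟨r, hr, s, hs, rfl⟩
          exact ⟨p * r + b ^ 2 * (q * s), add_mem (mul_mem hp hr) (mul_mem h2 (mul_mem hq hs)),
            p * s + q * r, add_mem (mul_mem hp hs) (mul_mem hq hr), by ring⟩
        add_mem' := by
          rintro _ _ ⟨p, hp, q, hq, rfl⟩ ⟨r, hr, s, hs, rfl⟩
          exact ⟨p + r, add_mem hp hr, q + s, add_mem hq hs, by ring⟩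
        algebraMap_mem' := fun a => ⟨_, D.algebraMap_mem a, 0, D.zero_mem, by simp⟩ }
    have hE : D ⊔ Algebra.adjoin k {b} ≤ E := by
      refine sup_le (fun d hd => ⟨d, hd, 0, D.zero_mem, by simp⟩) ?_
      rw [Algebra.adjoin_le_iff, Set.singleton_subset_iff]
      exact ⟨0, D.zero_mem, 1, D.one_mem, by simp⟩
    exact hE hz
  · rintro ⟨p, hp, q, hq, rfl⟩
    exact add_mem (le_sup_left (a := D) hp) (mul_mem
      (le_sup_right (a := D) (Algebra.subset_adjoin rfl)) (le_sup_left (a := D) hq))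

/-- The common end of the arguments by nilpotence: a `D`-module containing `b ^ 4 D[b]` and an
element of `D` congruent to `1` modulo `b` contains `1`. -/
theorem one_mem_of_mem_of_nilpotent {D : Subalgebra k Ω} {b t w : Ω} {X : Submodule k Ω}
    (hX : D.toSubmodule * X ≤ X) (ht : t ∈ X) (htD : t ∈ D) (htw : t = 1 - b * w)
    (hb : b ^ 4 * w ^ 4 ∈ X) : (1 : Ω) ∈ X := by
  have h : (1 : Ω) = (4 - 6 * t + 4 * t ^ 2 - t ^ 3) * t + b ^ 4 * w ^ 4 := by
    subst htw; ring
  rw [h]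
  refine add_mem (hX (Submodule.mul_mem_mul ?_ ht)) hb
  have h4 : (4 : Ω) ∈ D := ofNat_mem D 4
  have h6 : (6 : Ω) ∈ D := ofNat_mem D 6
  rw [Subalgebra.mem_toSubmodule]
  exact sub_mem (add_mem (sub_mem h4 (mul_mem h6 htD)) (mul_mem h4 (pow_mem htD 2))) (pow_mem htD 3)

theorem mul_eq_of_one_mem {D : Subalgebra k Ω} {I J : Submodule k Ω} (hI : D.toSubmodule * I ≤ I)
    (h : I * J ≤ D.toSubmodule) (h1 : (1 : Ω) ∈ I * J) : I * J = D.toSubmodule := by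
  refine le_antisymm h fun d hd => ?_
  have : d * 1 ∈ D.toSubmodule * (I * J) := Submodule.mul_mem_mul hd h1
  rw [mul_one, ← mul_assoc] at this
  exact mul_mono_left hI this

/-- With `∑ x i * y i = 1`, the matrix `(y i * x j)` is idempotent over `E`. Write it as `P + bQ`
with `P`, `Q` over `D`. The corrected generators `x' = xP` and `y' = Py` have all products in `D`,
and agree with `x`, `y` modulo `b`. Adding `b ^ 2 I` and `b ^ 2 J`, which costs nothing because `b ^
2 E ⊂ D`, makes up for the error. -/
theorem IsElementarySubintegral.exists_descent {D E : Subalgebra k Ω}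
    (h : IsElementarySubintegral D E) {I J : Submodule k Ω} (hIJ : I * J = E.toSubmodule)
    (hI : E.toSubmodule * I ≤ I) (hJ : E.toSubmodule * J ≤ J) :
    ∃ I₀ ≤ I, ∃ J₀ ≤ J, I₀ * J₀ = D.toSubmodule ∧ D.toSubmodule * I₀ ≤ I₀ ∧
      D.toSubmodule * J₀ ≤ J₀ := by
  obtain ⟨b, h2, h3, rfl⟩ := h
  set E := D ⊔ Algebra.adjoin k {b} with hE
  have hDE : D ≤ E := le_sup_left
  have hbE : b ∈ E := le_sup_right (a := D) (Algebra.subset_adjoin rfl)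
  have hEI : ∀ {z x}, z ∈ E → x ∈ I → z * x ∈ I := fun hz hx => hI (Submodule.mul_mem_mul hz hx)
  have hEJ : ∀ {z x}, z ∈ E → x ∈ J → z * x ∈ J := fun hz hx => hJ (Submodule.mul_mem_mul hz hx)
  have hIJm : ∀ {x y}, x ∈ I → y ∈ J → x * y ∈ E := fun hx hy => by
    have := Submodule.mul_mem_mul hx hy
    rwa [hIJ] at this
  have hcond : ∀ {z}, z ∈ E → b ^ 2 * z ∈ D := fun hz =>
    mul_mem_of_sq_of_cube h2 h3 ((mem_sup_adjoin_iff h2).1 hz)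
  obtain ⟨n, x, y, hx, hy, hxy⟩ := Submodule.exists_fin_sum_of_mem_mul
    (show (1 : Ω) ∈ I * J by rw [hIJ]; exact E.one_mem)
  have hdec : ∀ i j, ∃ p ∈ D, ∃ q ∈ D, y i * x j = p + b * q := fun i j =>
    (mem_sup_adjoin_iff h2).1 (by rw [mul_comm]; exact hIJm (hx j) (hy i))
  choose p hp q hq hpq using hdec
  let P : Matrix (Fin n) (Fin n) Ω := Matrix.of p
  let Q : Matrix (Fin n) (Fin n) Ω := Matrix.of q
  let MD : Subring (Matrix (Fin n) (Fin n) Ω) := D.toSubring.matrix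
  have hP : P ∈ MD := fun i j => hp i j
  have hQ : Q ∈ MD := fun i j => hq i j
  have hsmul : ∀ {c : Ω} {A : Matrix (Fin n) (Fin n) Ω}, c ∈ D → A ∈ MD → c • A ∈ MD :=
    fun hc hA i j => D.mul_mem hc (hA i j)
  have hcol : P + b • Q = Matrix.of fun i j => y i * x j := by
    ext i j; simp [P, Q, hpq]
  have hidem : (P + b • Q) * (P + b • Q) = P + b • Q := by
    rw [hcol]
    ext i j
    simp only [Matrix.mul_apply, Matrix.of_apply]
    calc ∑ l, y i * x l * (y l * x j) = y i * x j * ∑ l, x l * y l := by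
          rw [Finset.mul_sum]; exact Finset.sum_congr rfl fun l _ => by ring
      _ = y i * x j := by rw [hxy, mul_one]
  have hexp : P * P + b • (P * Q + Q * P) + b ^ 2 • (Q * Q) = P + b • Q := by
    rw [← hidem]
    simp only [add_mul, mul_add, Matrix.smul_mul, Matrix.mul_smul, smul_add, smul_smul, sq]
    abel
  -- The analogue of `e e' e = 0` for the derivative of an idempotent. Modulo matrices over `D`,
  -- `hexp` says `b(PQ + QP) ≡ bQ`, and multiplied by `bQ` it says `bP²Q ≡ bPQ`, as `b ^ 2` and `b ^
  -- 3` lie in `D`. Multiplying the first congruence by `P` on the left leaves `bPQP ≡ 0`.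
  have hPQP : b • (P * Q * P) ∈ MD := by
    have e1 : b • (P * Q + Q * P) = P + b • Q - P * P - b ^ 2 • (Q * Q) := by
      rw [← hexp]; abel
    have e2 : P * P = P + b • Q - b • (P * Q + Q * P) - b ^ 2 • (Q * Q) := by
      rw [← hexp]; abel
    have e3 : b • (P * Q * P) = P * (b • (P * Q + Q * P)) - b • ((P * P) * Q) := by
      simp only [mul_add, Matrix.mul_smul, smul_add, mul_assoc]
      abel
    have e4 : b • (P * P * Q) = b • (P * Q) + b ^ 2 • (Q * Q) - b ^ 2 • ((P * Q + Q * P) * Q)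
        - b ^ 3 • (Q * Q * Q) := by
      rw [e2]
      simp only [sub_mul, add_mul, Matrix.smul_mul, smul_add, smul_sub, smul_smul, mul_assoc,
        ← pow_succ', ← sq]
    have e5 : b • (P * Q * P) = P * P - P * (P * P) - b ^ 2 • (P * (Q * Q))
        - b ^ 2 • (Q * Q) + b ^ 2 • ((P * Q + Q * P) * Q) + b ^ 3 • (Q * Q * Q) := by
      rw [e3, e4, e1]
      simp only [mul_add, mul_sub, Matrix.mul_smul]
      abel
    rw [e5]
    exact add_mem (add_mem (sub_mem (sub_mem (sub_mem (mul_mem hP hP) (mul_mem hP (mul_mem hP hP)))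
      (hsmul h2 (mul_mem hP (mul_mem hQ hQ)))) (hsmul h2 (mul_mem hQ hQ)))
      (hsmul h2 (mul_mem (add_mem (mul_mem hP hQ) (mul_mem hQ hP)) hQ)))
      (hsmul h3 (mul_mem (mul_mem hQ hQ) hQ))
  let x' : Fin n → Ω := fun j => ∑ i, x i * p i j
  let y' : Fin n → Ω := fun i => ∑ j, p i j * y j
  have hx' : ∀ j, x' j ∈ I := fun j => sum_mem fun i _ => by
    rw [mul_comm]; exact hEI (hDE (hp i j)) (hx i)
  have hy' : ∀ i, y' i ∈ J := fun i => sum_mem fun j _ => hEJ (hDE (hp i j)) (hy j)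
  have hprod : ∀ i j, y' i * x' j = (P * (P + b • Q) * P) i j := fun i j => by
    rw [hcol]
    simp only [Matrix.mul_apply, Matrix.of_apply, y', x', P, Finset.sum_mul, Finset.mul_sum]
    exact Finset.sum_congr rfl fun _ _ => Finset.sum_congr rfl fun _ _ => by ring
  have hx'y' : ∀ i j, y' i * x' j ∈ D := fun i j => by
    rw [hprod]
    have : P * (P + b • Q) * P = P * P * P + b • (P * Q * P) := by
      simp only [mul_add, add_mul, Matrix.mul_smul, Matrix.smul_mul]
    rw [this]
    exact add_mem (mul_mem (mul_mem hP hP) hP) hPQP i j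
  let I₁ := Submodule.span k (Set.range x')
  let J₁ := Submodule.span k (Set.range y')
  let b2 := Submodule.span k {b ^ 2}
  have hD2 : D.toSubmodule * D.toSubmodule = D.toSubmodule := D.isIdempotentElem_toSubmodule
  have hDE' : D.toSubmodule ≤ E.toSubmodule := hDE
  have hDI : D.toSubmodule * I ≤ I := (mul_mono_left hDE').trans hI
  have hDJ : D.toSubmodule * J ≤ J := (mul_mono_left hDE').trans hJ
  have hb2E : b2 * E.toSubmodule ≤ D.toSubmodule := by
    rw [Submodule.mul_le]
    intro m hm z hz
    obtain ⟨c, rfl⟩ := Submodule.mem_span_singleton.1 hm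
    rw [Algebra.smul_mul_assoc]
    exact D.smul_mem (hcond hz) c
  have hb2 : b2 ≤ E.toSubmodule := by
    rw [Submodule.span_le, Set.singleton_subset_iff]
    exact hDE h2
  have hI₁ : I₁ ≤ I := Submodule.span_le.2 (by rintro _ ⟨j, rfl⟩; exact hx' j)
  have hJ₁ : J₁ ≤ J := Submodule.span_le.2 (by rintro _ ⟨j, rfl⟩; exact hy' j)
  have hIJ₁ : I₁ * J₁ ≤ D.toSubmodule := by
    rw [Submodule.span_mul_span, Submodule.span_le]
    rintro _ ⟨_, ⟨i, rfl⟩, _, ⟨j, rfl⟩, rfl⟩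
    change x' i * y' j ∈ D
    rw [mul_comm]
    exact hx'y' j i
  set I₀ := D.toSubmodule * I₁ + b2 * I with hI₀
  set J₀ := D.toSubmodule * J₁ + b2 * J with hJ₀
  have hDI₀ : D.toSubmodule * I₀ ≤ I₀ := by
    rw [hI₀, mul_add, ← mul_assoc, hD2, mul_left_comm]
    exact add_le_add le_rfl (mul_mono_right hDI)
  have hDJ₀ : D.toSubmodule * J₀ ≤ J₀ := by
    rw [hJ₀, mul_add, ← mul_assoc, hD2, mul_left_comm]
    exact add_le_add le_rfl (mul_mono_right hDJ)
  have hII : I₀ ≤ I := by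
    rw [hI₀, Submodule.add_eq_sup]
    exact sup_le ((mul_mono_right hI₁).trans hDI) ((mul_mono_left hb2).trans hI)
  have hJJ : J₀ ≤ J := by
    rw [hJ₀, Submodule.add_eq_sup]
    exact sup_le ((mul_mono_right hJ₁).trans hDJ) ((mul_mono_left hb2).trans hJ)
  have hle : I₀ * J₀ ≤ D.toSubmodule := by
    have : I₀ * J₀ = D.toSubmodule * D.toSubmodule * (I₁ * J₁) + b2 * (D.toSubmodule * I₁ * J)
        + b2 * (I * J₀) := by
      rw [hI₀, hJ₀]; ring
    rw [this]
    simp only [Submodule.add_eq_sup]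
    refine sup_le (sup_le ?_ ?_) ?_
    · rw [hD2]; exact mul_mono_right hIJ₁ |>.trans hD2.le
    · refine (mul_mono_right ?_).trans hb2E
      rw [← hIJ]
      exact mul_mono_left ((mul_mono_right hI₁).trans hDI)
    · refine (mul_mono_right ?_).trans hb2E
      rw [← hIJ]
      exact mul_mono_right hJJ
  refine ⟨I₀, hII, J₀, hJJ, mul_eq_of_one_mem hDI₀ hle ?_, hDI₀, hDJ₀⟩
  have hI₁₀ : I₁ ≤ I₀ := fun z hz => Submodule.mem_sup_left (by
    simpa using Submodule.mul_mem_mul (show (1 : Ω) ∈ D.toSubmodule from D.one_mem) hz)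
  have hJ₁₀ : J₁ ≤ J₀ := fun z hz => Submodule.mem_sup_left (by
    simpa using Submodule.mul_mem_mul (show (1 : Ω) ∈ D.toSubmodule from D.one_mem) hz)
  have ht : ∑ i, x' i * y' i ∈ I₀ * J₀ := sum_mem fun i _ => Submodule.mul_mem_mul
    (hI₁₀ (Submodule.subset_span ⟨i, rfl⟩)) (hJ₁₀ (Submodule.subset_span ⟨i, rfl⟩))
  have hPe : ∀ i j, p i j = y i * x j - b * q i j := fun i j => by rw [hpq]; ring
  have hE2 : ∀ i j, y i * x j ∈ E := fun i j => by rw [mul_comm]; exact hIJm (hx j) (hy i)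
  have hE2' : ∀ i j, x j * y i ∈ E := fun i j => hIJm (hx j) (hy i)
  -- Since `P` differs from `(y i * x j)` by `bQ`, `x'` and `y'` differ from `x` and `y` by
  -- multiples of `b` in `I` and `J`. The remainder `(bw) ^ 4` will lie in `b ^ 2 I * b ^ 2 J`.
  obtain ⟨w, hw, hwt⟩ : ∃ w ∈ E, ∑ i, x' i * y' i = 1 - b * w := by
    have key : ∀ j, ∃ w ∈ J, y' j = y j - b * w := fun j =>
      ⟨∑ l, q j l * y l, sum_mem fun l _ => hEJ (hDE (hq j l)) (hy l), by
        simp only [y', hPe, sub_mul, Finset.sum_sub_distrib, Finset.mul_sum]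
        congr 1
        · calc ∑ l, y j * x l * y l = y j * ∑ l, x l * y l := by
                rw [Finset.mul_sum]; exact Finset.sum_congr rfl fun l _ => by ring
            _ = y j := by rw [hxy, mul_one]
        · exact Finset.sum_congr rfl fun l _ => by ring⟩
    have key' : ∀ j, ∃ w ∈ I, x' j = x j - b * w := fun j =>
      ⟨∑ l, q l j * x l, sum_mem fun l _ => hEI (hDE (hq l j)) (hx l), by
        simp only [x', hPe, mul_sub, Finset.sum_sub_distrib, Finset.mul_sum]
        congr 1
        · calc ∑ l, x l * (y l * x j) = x j * ∑ l, x l * y l := by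
                rw [Finset.mul_sum]; exact Finset.sum_congr rfl fun l _ => by ring
            _ = x j := by rw [hxy, mul_one]
        · exact Finset.sum_congr rfl fun l _ => by ring⟩
    choose w hw hw' using key
    choose v hv hv' using key'
    refine ⟨∑ i, (x i * w i + v i * y i - b * (v i * w i)), sum_mem fun i _ => sub_mem (add_mem
      (hIJm (hx i) (hw i)) (hIJm (hv i) (hy i))) (mul_mem hbE (hIJm (hv i) (hw i))), ?_⟩
    rw [← hxy, Finset.mul_sum, ← Finset.sum_sub_distrib]
    exact Finset.sum_congr rfl fun i _ => by rw [hw', hv']; ring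
  refine one_mem_of_mem_of_nilpotent (D := D) (b := b) ?_ ht (hle ht) hwt ?_
  · rw [← mul_assoc]; exact mul_mono_left hDI₀
  · have h4 : w ^ 4 ∈ I * J := by rw [hIJ]; exact pow_mem hw 4
    have hb : b ^ 2 ∈ b2 := Submodule.mem_span_singleton_self _
    have : b ^ 2 * b ^ 2 * w ^ 4 ∈ b2 * b2 * (I * J) :=
      Submodule.mul_mem_mul (Submodule.mul_mem_mul hb hb) h4
    rw [show b ^ 4 = b ^ 2 * b ^ 2 by ring]
    rw [mul_mul_mul_comm] at this
    have hle₁ : b2 * I ≤ I₀ := by rw [hI₀, Submodule.add_eq_sup]; exact le_sup_right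
    have hle₂ : b2 * J ≤ J₀ := by rw [hJ₀, Submodule.add_eq_sup]; exact le_sup_right
    exact (mul_le_mul' hle₁ hle₂) this

/-- The bottom ring `D` is left arbitrary so that chains starting at `A[X]` inside the `A`-algebra
`C[X]` are also covered. -/
theorem exists_descent {D E : Subalgebra k Ω}
    (h : Relation.ReflTransGen IsElementarySubintegral D E) {I J : Submodule k Ω}
    (hIJ : I * J = E.toSubmodule) (hI : E.toSubmodule * I ≤ I) (hJ : E.toSubmodule * J ≤ J) :
    ∃ I₀ ≤ I, ∃ J₀ ≤ J, I₀ * J₀ = D.toSubmodule ∧ D.toSubmodule * I₀ ≤ I₀ ∧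
      D.toSubmodule * J₀ ≤ J₀ := by
  induction h generalizing I J with
  | refl => exact ⟨I, le_rfl, J, le_rfl, hIJ, hI, hJ⟩
  | tail _ h ih =>
    obtain ⟨I₁, hI₁, J₁, hJ₁, h₁, hI', hJ'⟩ := h.exists_descent hIJ hI hJ
    obtain ⟨I₀, hI₀, J₀, hJ₀, h₀⟩ := ih h₁ hI' hJ'
    exact ⟨I₀, hI₀.trans hI₁, J₀, hJ₀.trans hJ₁, h₀⟩

end Descent

/-! ### Formal properties of the subintegral closure. -/

section Closure

variable {A : Type*} {B : Type*} {B' : Type*} [CommRing A] [CommRing B] [CommRing B'] [Algebra A B]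
  [Algebra A B']

theorem IsElementarySubintegral.map {D E : Subalgebra A B} (h : IsElementarySubintegral D E)
    (f : B →ₐ[A] B') : IsElementarySubintegral (D.map f) (E.map f) := by
  obtain ⟨b, h2, h3, rfl⟩ := h
  exact ⟨f b, ⟨_, h2, map_pow f b 2⟩, ⟨_, h3, map_pow f b 3⟩, by
    rw [Algebra.map_sup, AlgHom.map_adjoin_singleton]⟩

theorem IsFiniteSubintegral.map {D : Subalgebra A B} (h : IsFiniteSubintegral D) (f : B →ₐ[A] B') :
    IsFiniteSubintegral (D.map f) := by
  unfold IsFiniteSubintegral at h ⊢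
  rw [← Algebra.map_bot f]
  exact Relation.ReflTransGen.lift (Subalgebra.map f)
    (fun _ _ h => IsElementarySubintegral.map h f) _ _ h

theorem IsFiniteSubintegral.le_subintegralClosure {D : Subalgebra A B}
    (h : IsFiniteSubintegral D) : D ≤ subintegralClosure A B := fun _ hb => ⟨D, h, hb⟩

theorem exists_isFiniteSubintegral_of_finite {s : Set B} (hs : s.Finite)
    (h : s ⊆ subintegralClosure A B) : ∃ D : Subalgebra A B, IsFiniteSubintegral D ∧ s ⊆ D := by
  induction s, hs using Set.Finite.induction_on with
  | empty => exact ⟨⊥, Relation.ReflTransGen.refl, by simp⟩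
  | insert _ _ ih =>
    obtain ⟨D, hD, hsD⟩ := ih ((Set.subset_insert _ _).trans h)
    obtain ⟨E, hE, haE⟩ := h (Set.mem_insert _ _)
    exact ⟨D ⊔ E, hD.sup hE, Set.insert_subset (le_sup_right (a := D) haE)
      (hsD.trans (le_sup_left (a := D)))⟩

theorem mem_subintegralClosure_of_sq_of_cube {b : B} (h2 : b ^ 2 ∈ subintegralClosure A B)
    (h3 : b ^ 3 ∈ subintegralClosure A B) : b ∈ subintegralClosure A B := by
  obtain ⟨D, hD, h2⟩ := h2
  obtain ⟨E, hE, h3⟩ := h3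
  refine ⟨D ⊔ E ⊔ Algebra.adjoin A {b}, (hD.sup hE).tail ⟨b, le_sup_left (a := D) h2,
    le_sup_right (a := D) h3, rfl⟩, le_sup_right (a := D ⊔ E) (Algebra.subset_adjoin rfl)⟩

/-- The adjoined elements all lie in the closure, so the chain can be carried out there. This makes
the closure subintegral over `A` without reference to `B`. -/
theorem exists_map_val_eq {D : Subalgebra A B} (h : IsFiniteSubintegral D) :
    ∃ D' : Subalgebra A (subintegralClosure A B), IsFiniteSubintegral D' ∧
      D'.map (subintegralClosure A B).val = D := by
  have h' := h
  unfold IsFiniteSubintegral at h'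
  induction h' with
  | refl => exact ⟨⊥, Relation.ReflTransGen.refl, Algebra.map_bot _⟩
  | @tail E F hE hEF ih =>
    have hF : F ≤ subintegralClosure A B := h.le_subintegralClosure
    obtain ⟨D', hD', rfl⟩ := ih hE
    obtain ⟨b, h2, h3, rfl⟩ := hEF
    have hb : b ∈ subintegralClosure A B :=
      hF (Algebra.mem_sup_right (Algebra.self_mem_adjoin_singleton A b))
    lift b to subintegralClosure A B using hb
    refine ⟨D' ⊔ Algebra.adjoin A {b}, hD'.tail ⟨b, ?_, ?_, rfl⟩, ?_⟩
    · obtain ⟨z, hz, hzb⟩ := h2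
      rwa [← show z = b ^ 2 from Subtype.ext hzb]
    · obtain ⟨z, hz, hzb⟩ := h3
      rwa [← show z = b ^ 3 from Subtype.ext hzb]
    · rw [Algebra.map_sup, AlgHom.map_adjoin_singleton]
      rfl

variable (A B) in
theorem subintegralClosure_subintegralClosure :
    subintegralClosure A (subintegralClosure A B) = ⊤ := by
  refine eq_top_iff.2 fun b _ => ?_
  obtain ⟨D, hD, hb⟩ := b.2
  obtain ⟨D', hD', rfl⟩ := exists_map_val_eq hD
  obtain ⟨b', hb', h⟩ := hb
  exact ⟨D', hD', by rwa [← show b' = b from Subtype.ext h]⟩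

section BaseChange

variable {A' : Type*} [CommRing A'] {E : Type*} [CommRing E] [Algebra A' E]

/-- Subintegral closures are compatible with morphisms of ring extensions. -/
theorem map_mem_subintegralClosure {f : B →+* E} (hf : IsPairHom A A' f) {b : B}
    (hb : b ∈ subintegralClosure A B) : f b ∈ subintegralClosure A' E := by
  obtain ⟨D, hD, hb⟩ := hb
  unfold IsFiniteSubintegral at hD
  induction hD generalizing b with
  | refl =>
    obtain ⟨a, rfl⟩ := Algebra.mem_bot.1 hb
    obtain ⟨a', ha'⟩ := hf a
    rw [← ha']
    exact Subalgebra.algebraMap_mem _ _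
  | tail _ h ih =>
    obtain ⟨c, h2, h3, rfl⟩ := h
    obtain ⟨p, hp, q, hq, rfl⟩ := (mem_sup_adjoin_iff h2).1 hb
    have hc : f c ∈ subintegralClosure A' E := mem_subintegralClosure_of_sq_of_cube
      (by rw [← map_pow]; exact ih h2) (by rw [← map_pow]; exact ih h3)
    rw [map_add, map_mul]
    exact add_mem (ih hp) (mul_mem hc (ih hq))

end BaseChange

/-- A monomial with coefficient `b` is the product of a monomial from `A[M]` and the constant `b`;
the latter is in the closure by functoriality. -/
theorem subintegralClosure_monoidAlgebra_eq_top (h : subintegralClosure A B = ⊤)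
    (M : Type*) [CommMonoid M] :
    subintegralClosure (MonoidAlgebra A M) (MonoidAlgebra B M) = ⊤ := by
  refine eq_top_iff.2 fun x _ => ?_
  induction x using MonoidAlgebra.induction_linear with
  | zero => exact zero_mem _
  | add x y hx hy => exact add_mem (hx trivial) (hy trivial)
  | single m b =>
    have h1 : MonoidAlgebra.single (1 : M) b ∈
        subintegralClosure (MonoidAlgebra A M) (MonoidAlgebra B M) :=
      map_mem_subintegralClosure (A := A) (A' := MonoidAlgebra A M)
        (f := (MonoidAlgebra.singleOneRingHom : B →+* MonoidAlgebra B M))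
        (fun a => ⟨MonoidAlgebra.singleOneRingHom a, by simp⟩) (by rw [h]; trivial)
    have h2 : MonoidAlgebra.single m (1 : B) ∈
        subintegralClosure (MonoidAlgebra A M) (MonoidAlgebra B M) := by
      have := (subintegralClosure (MonoidAlgebra A M) (MonoidAlgebra B M)).algebraMap_mem
        (MonoidAlgebra.single m 1)
      simpa using this
    simpa [MonoidAlgebra.single_mul_single] using mul_mem h2 h1

end Closure

/-! ### Exactness of the rows. -/

section Exactness

variable {R S T : Type*} [CommRing R] [CommRing S] [CommRing T] [Algebra R S] [Algebra S T]
  [Algebra R T] [IsScalarTower R S T]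

theorem Inv.map_apply_coe {A B A' B' : Type*} [CommRing A] [CommRing B] [Algebra A B]
    [CommRing A'] [CommRing B'] [Algebra A' B'] (f : B →+* B') (hf : IsPairHom A A' f)
    (I : Inv A B) :
    (Inv.map f hf I : Submodule A' B') = Submodule.span A' (f '' (I : Submodule A B)) :=
  rfl

/-- Multiplying the inclusion of the inverses by `I * J` reverses it. -/
theorem Inv.eq_of_le {A B : Type*} [CommRing A] [CommRing B] [Algebra A B] {I J : Inv A B}
    (h : (I : Submodule A B) ≤ J) (h' : (↑I⁻¹ : Submodule A B) ≤ ↑J⁻¹) : I = J := by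
  refine Units.ext (le_antisymm h ?_)
  calc (J : Submodule A B) = I * ↑I⁻¹ * J := by simp
    _ ≤ I * ↑J⁻¹ * J := mul_mono_left (mul_mono_right h')
    _ = I := by simp [mul_assoc]

theorem Inv.eq_one_of_le {A B : Type*} [CommRing A] [CommRing B] [Algebra A B] {I : Inv A B}
    (h : (I : Submodule A B) ≤ 1) (h' : (↑I⁻¹ : Submodule A B) ≤ 1) : I = 1 :=
  Inv.eq_of_le h (by simpa using h')

/-- For a tower `R → S → T` with `S → T` injective, `𝓘(R, S) → 𝓘(R, T)` is injective. -/
theorem Inv.map_injective {R S T : Type*} [CommRing R] [CommRing S] [CommRing T] [Algebra R S]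
    [Algebra R T] (f : S →+* T) (hf : IsPairHom R R f) (hfR : ∀ (r : R) s, f (r • s) = r • f s)
    (hinj : Function.Injective f) : Function.Injective (Inv.map f hf) := by
  have key : ∀ I : Submodule R S,
      Submodule.span R (f '' I) = I.map ({ f with map_smul' := hfR } : S →ₗ[R] T) := fun I => by
    rw [← Submodule.span_eq (I.map _)]; rfl
  intro I J h
  have h := congrArg Units.val h
  rw [Inv.map_apply_coe, Inv.map_apply_coe, key, key] at h
  exact Units.ext (Submodule.map_injective_of_injective hinj h)

/-- Exactness of `𝓘(R, S) → 𝓘(R, T) → 𝓘(S, T)` in the middle. -/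
theorem Inv.map_mulExact (f : S →+* T) (hf : IsPairHom R R f) (hfS : f = algebraMap S T)
    (hid : IsPairHom R S (RingHom.id T)) (hinj : Function.Injective f) :
    Function.MulExact (Inv.map f hf) (Inv.map (A' := S) (RingHom.id T) hid) := by
  subst hfS
  have hfR : ∀ (r : R) (s : S), algebraMap S T (r • s) = r • algebraMap S T s := fun r s => by
    rw [Algebra.smul_def, map_mul, ← IsScalarTower.algebraMap_apply, ← Algebra.smul_def]
  let F : S →ₐ[R] T := IsScalarTower.toAlgHom R S T
  have key : ∀ I : Submodule R S, Submodule.span R (algebraMap S T '' I) = I.map F.toLinearMap :=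
    fun I => by rw [← Submodule.span_eq (I.map _)]; rfl
  intro J
  constructor
  · intro h
    have h₁ : ∀ J : Inv R T, Inv.map (A' := S) (RingHom.id T) hid J = 1 →
        (J : Submodule R T) ≤ LinearMap.range F.toLinearMap := by
      intro J h x hx
      have : x ∈ (Inv.map (A' := S) (RingHom.id T) hid J : Submodule S T) :=
        Submodule.subset_span ⟨x, hx, rfl⟩
      rw [h, Units.val_one, Submodule.mem_one] at this
      obtain ⟨s, hs⟩ := this
      exact ⟨s, hs⟩
    have hmap : ∀ J : Inv R T, Inv.map (A' := S) (RingHom.id T) hid J = 1 →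
        ((J : Submodule R T).comap F.toLinearMap).map F.toLinearMap = J := fun J h =>
      Submodule.map_comap_eq_of_le (h₁ J h)
    have h' : Inv.map (A' := S) (RingHom.id T) hid J⁻¹ = 1 := by rw [map_inv, h, inv_one]
    have hmul : ((J : Submodule R T).comap F.toLinearMap) *
        ((↑J⁻¹ : Submodule R T).comap F.toLinearMap) = 1 := by
      apply Submodule.map_injective_of_injective (f := F.toLinearMap) hinj
      rw [Submodule.map_mul, hmap J h, hmap _ h', Submodule.map_one]
      simp
    refine ⟨⟨_, _, hmul, by rw [mul_comm, hmul]⟩, Units.ext ?_⟩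
    rw [Inv.map_apply_coe, key]
    exact hmap J h
  · rintro ⟨I, rfl⟩
    have h₁ : ∀ I : Inv R S,
        (Inv.map (A' := S) (RingHom.id T) hid (Inv.map (algebraMap S T) hf I) :
          Submodule S T) ≤ 1 := by
      intro I
      rw [Inv.map_apply_coe, Submodule.span_le]
      rintro _ ⟨x, hx, rfl⟩
      rw [Inv.map_apply_coe, key] at hx
      obtain ⟨s, -, rfl⟩ := hx
      exact Submodule.mem_one.2 ⟨s, rfl⟩
    exact Inv.eq_one_of_le (h₁ I) (by rw [← map_inv, ← map_inv]; exact h₁ I⁻¹)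

/-- If `R ⊂ S` is subintegral then `𝓘(R, T) → 𝓘(S, T)` is surjective. -/
theorem Inv.map_surjective (hid : IsPairHom R S (RingHom.id T))
    (h : subintegralClosure R S = ⊤) :
    Function.Surjective (Inv.map (A' := S) (RingHom.id T) hid) := by
  intro J
  let F : S →ₐ[R] T := IsScalarTower.toAlgHom R S T
  obtain ⟨n, x, y, hx, hy, hxy⟩ := Submodule.exists_fin_sum_of_mem_mul
    (show (1 : T) ∈ (J : Submodule S T) * ↑J⁻¹ by
      rw [Units.mul_inv]; exact Submodule.one_le.1 le_rfl)
  have hs : ∀ i j, ∃ s : S, algebraMap S T s = x i * y j := fun i j => by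
    have := Submodule.mul_mem_mul (hx i) (hy j)
    rw [Units.mul_inv] at this
    exact Submodule.mem_one.1 this
  choose s hs using hs
  -- The finitely many products `x i * y j` come from one `D` reached by a finite chain. Over its
  -- image `E` in `T` the spans of `x` and of `y` are already mutually inverse, so descent to `R`
  -- applies there.
  obtain ⟨D, hD, hsD⟩ := exists_isFiniteSubintegral_of_finite (A := R)
    (Set.finite_range fun p : Fin n × Fin n => s p.1 p.2) (by rw [h]; exact fun _ _ => trivial)
  set E := D.map F
  have hE : IsFiniteSubintegral E := hD.map F
  let X := Submodule.span R (Set.range x)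
  let Y := Submodule.span R (Set.range y)
  have hEE : E.toSubmodule * E.toSubmodule = E.toSubmodule := E.isIdempotentElem_toSubmodule
  have hXY : X * Y ≤ E.toSubmodule := by
    rw [Submodule.span_mul_span, Submodule.span_le]
    rintro _ ⟨_, ⟨i, rfl⟩, _, ⟨j, rfl⟩, rfl⟩
    exact ⟨s i j, hsD ⟨(i, j), rfl⟩, hs i j⟩
  have h1 : (1 : T) ∈ X * Y := by
    rw [← hxy]
    exact sum_mem fun i _ => Submodule.mul_mem_mul (Submodule.subset_span ⟨i, rfl⟩)
      (Submodule.subset_span ⟨i, rfl⟩)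
  have hIJ : (E.toSubmodule * X) * (E.toSubmodule * Y) = E.toSubmodule := by
    refine mul_eq_of_one_mem (by rw [← mul_assoc, hEE]) ?_ ?_
    · rw [mul_mul_mul_comm, hEE]
      exact (mul_mono_right hXY).trans hEE.le
    · rw [mul_mul_mul_comm, hEE]
      simpa using Submodule.mul_mem_mul (show (1 : T) ∈ E.toSubmodule from E.one_mem) h1
  obtain ⟨I₀, hI₀, J₀, hJ₀, hIJ₀, -, -⟩ := exists_descent hE hIJ
    (by rw [← mul_assoc, hEE]) (by rw [← mul_assoc, hEE])
  rw [Algebra.toSubmodule_bot] at hIJ₀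
  have hmem : ∀ (K : Submodule S T) (z : Fin n → T), (∀ i, z i ∈ K) →
      E.toSubmodule * Submodule.span R (Set.range z) ≤ K.restrictScalars R := by
    intro K z hz
    rw [Submodule.mul_le]
    rintro _ ⟨d, -, rfl⟩ w hw
    have : w ∈ K.restrictScalars R :=
      (Submodule.span_le.2 (by rintro _ ⟨i, rfl⟩; exact hz i) :
        Submodule.span R (Set.range z) ≤ _) hw
    have := K.smul_mem d this
    rwa [Algebra.smul_def] at this
  let I : Inv R T := ⟨I₀, J₀, hIJ₀, by rw [mul_comm, hIJ₀]⟩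
  refine ⟨I, Inv.eq_of_le ?_ ?_⟩
  · rw [Inv.map_apply_coe, Submodule.span_le]
    rintro _ ⟨z, hz, rfl⟩
    exact hmem J x hx (hI₀ hz)
  · rw [← map_inv, Inv.map_apply_coe, Submodule.span_le]
    rintro _ ⟨z, hz, rfl⟩
    exact hmem _ y hy (hJ₀ hz)

end Exactness

/-! ### The Dedekind-Mertens lemma and Kronecker's theorem. -/

section DedekindMertens

open Polynomial

variable (R : Type*) {S : Type*} [CommRing R] [CommRing S] [Algebra R S]

/-- The `R`-submodule generated by the coefficients of a polynomial over an `R`-algebra. -/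
def content (f : S[X]) : Submodule R S := Submodule.span R (Set.range f.coeff)

variable {R}

theorem coeff_mem_content (f : S[X]) (n : ℕ) : f.coeff n ∈ content R f :=
  Submodule.subset_span ⟨n, rfl⟩

theorem content_le {f : S[X]} {N : Submodule R S} : content R f ≤ N ↔ ∀ n, f.coeff n ∈ N :=
  Submodule.span_le.trans Set.range_subset_iff

theorem content_fg (f : S[X]) : (content R f).FG := by
  have : content R f = Submodule.span R (f.coeff '' (f.support : Set ℕ)) := by
    refine le_antisymm (content_le.2 fun n => ?_) (Submodule.span_mono (Set.image_subset_range _ _))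
    by_cases hn : n ∈ f.support
    · exact Submodule.subset_span ⟨n, hn, rfl⟩
    · rw [notMem_support_iff.1 hn]
      exact zero_mem _
  rw [this]
  exact Submodule.fg_span (f.support.finite_toSet.image _)

theorem content_sub_le (f g : S[X]) : content R (f - g) ≤ content R f ⊔ content R g :=
  content_le.2 fun n => by
    rw [coeff_sub]
    exact sub_mem (Submodule.mem_sup_left (coeff_mem_content f n))
      (Submodule.mem_sup_right (coeff_mem_content g n))

theorem content_C_mul (a : S) (f : S[X]) :
    content R (C a * f) = Submodule.span R {a} * content R f := by
  refine le_antisymm (content_le.2 fun n => ?_) ?_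
  · rw [coeff_C_mul]
    exact Submodule.mul_mem_mul (Submodule.mem_span_singleton_self a) (coeff_mem_content f n)
  · rw [content, Submodule.span_mul_span, Submodule.span_le]
    rintro _ ⟨a', ha', _, ⟨n, rfl⟩, rfl⟩
    rw [Set.mem_singleton_iff.1 ha']
    change a * f.coeff n ∈ _
    rw [← coeff_C_mul]
    exact coeff_mem_content _ _

theorem content_X_pow_mul_le (m : ℕ) (f : S[X]) : content R (X ^ m * f) ≤ content R f :=
  content_le.2 fun n => by
    rw [coeff_X_pow_mul']
    split_ifs
    · exact coeff_mem_content _ _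
    · exact zero_mem _

theorem content_eraseLead_le (f : S[X]) : content R f.eraseLead ≤ content R f :=
  content_le.2 fun n => by
    rw [eraseLead_coeff]
    split_ifs
    · exact zero_mem _
    · exact coeff_mem_content _ _

theorem content_le_sup_eraseLead (f : S[X]) :
    content R f ≤ Submodule.span R {f.leadingCoeff} ⊔ content R f.eraseLead :=
  content_le.2 fun n => by
    by_cases hn : n = f.natDegree
    · rw [hn]
      exact Submodule.mem_sup_left (Submodule.mem_span_singleton_self _)
    · rw [← eraseLead_coeff_of_ne n hn]
      exact Submodule.mem_sup_right (coeff_mem_content _ _)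

/-- Replace the factors `P` by `a + P'` one at a time: a term with a factor `a` falls under `h₁`,
and the one without falls under `h₂`. -/
theorem pow_succ_mul_le_of_le_sup {P a P' Q N : Submodule R S} {n : ℕ} (hP : P ≤ a ⊔ P')
    (hP' : P' ≤ P) (h₁ : a * (P ^ n * Q) ≤ N) (h₂ : P' ^ (n + 1) * Q ≤ N) :
    P ^ (n + 1) * Q ≤ N := by
  have key : ∀ j, j ≤ n + 1 → P' ^ (n + 1 - j) * P ^ j * Q ≤ N := by
    intro j hj
    induction j with
    | zero => simpa using h₂
    | succ j ih =>
      have e : n + 1 - j = (n + 1 - (j + 1)) + 1 := by omega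
      calc P' ^ (n + 1 - (j + 1)) * P ^ (j + 1) * Q
          = P * (P' ^ (n + 1 - (j + 1)) * P ^ j * Q) := by ring
        _ ≤ (a + P') * (P' ^ (n + 1 - (j + 1)) * P ^ j * Q) := mul_mono_left hP
        _ = a * (P' ^ (n + 1 - (j + 1)) * P ^ j * Q) + P' ^ (n + 1 - j) * P ^ j * Q := by
          rw [e]; ring
        _ ≤ N := by
          rw [Submodule.add_eq_sup]
          refine sup_le (le_trans ?_ h₁) (ih (by omega))
          refine mul_mono_right (mul_mono_left ?_)
          calc _ ≤ P ^ (n + 1 - (j + 1)) * P ^ j := mul_mono_left (pow_le_pow_left' hP' _)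
            _ = P ^ n := by rw [← pow_add]; congr 1; omega
  simpa using key (n + 1) le_rfl

/-- The Dedekind-Mertens lemma. -/
theorem content_pow_mul_content_le (n : ℕ) (f g : S[X]) (hg : g.natDegree ≤ n) :
    content R f ^ (n + 1) * content R g ≤ content R f ^ n * content R (f * g) := by
  induction n generalizing f g with
  | zero =>
    rw [eq_C_of_natDegree_eq_zero (Nat.le_zero.1 hg), mul_comm f, content_C_mul]
    have : content R (C (g.coeff 0)) ≤ Submodule.span R {g.coeff 0} := content_le.2 fun n => by
      rw [coeff_C]
      split_ifs
      · exact Submodule.mem_span_singleton_self _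
      · exact zero_mem _
    rw [pow_zero, one_mul, zero_add, pow_one, mul_comm]
    exact mul_mono_left this
  | succ n ihn =>
    induction hf : f.support.card generalizing f with
    | zero =>
      have : f = 0 := by simpa using hf
      subst this
      have : content R (0 : S[X]) = 0 := by
        rw [Submodule.zero_eq_bot, eq_bot_iff]
        exact content_le.2 fun n => by simp
      simp [this]
    | succ s ihs =>
      have hf0 : f ≠ 0 := by rintro rfl; simp at hf
      set a := f.leadingCoeff
      set m := f.natDegree
      set h := f * g
      set f' := f.eraseLead
      set b := g.coeff (n + 1)
      have hab : a * b ∈ content R h := by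
        have : h.coeff (m + (n + 1)) = a * b := coeff_mul_add_eq_of_natDegree_le le_rfl hg
        rw [← this]
        exact coeff_mem_content _ _
      -- Dropping the term of degree `n + 1` of `g` allows the induction on `n`, dropping the
      -- leading term of `f` the induction on the number of terms. Both corrections are controlled
      -- because `a * b` is a coefficient of `h`.
      set g' := g - C b * X ^ (n + 1) with hg'
      have hg'deg : g'.natDegree ≤ n := by
        rw [natDegree_le_iff_coeff_eq_zero]
        intro N hN
        rw [hg', coeff_sub, coeff_C_mul, coeff_X_pow]
        split_ifs with hN'
        · rw [hN']; simp [b]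
        · rw [coeff_eq_zero_of_natDegree_lt (by omega : g.natDegree < N)]; simp
      have hab' : content R (C (a * b) * f) ≤ content R f * content R h := by
        rw [content_C_mul, mul_comm]
        refine mul_mono_right ?_
        rw [Submodule.span_le, Set.singleton_subset_iff]
        exact hab
      have ha : Submodule.span R {a} ≤ content R f := by
        rw [Submodule.span_le, Set.singleton_subset_iff]
        exact coeff_mem_content _ _
      have h₁ : Submodule.span R {a} * content R (f * g') ≤ content R f * content R h := by
        rw [← content_C_mul]
        have : C a * (f * g') = C a * h - X ^ (n + 1) * (C (a * b) * f) := by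
          rw [hg', C_mul]; ring
        rw [this]
        refine (content_sub_le _ _).trans (sup_le ?_ ((content_X_pow_mul_le _ _).trans hab'))
        rw [content_C_mul]
        exact mul_mono_left ha
      have h₂ : Submodule.span R {a} * (content R f ^ (n + 1) * content R g') ≤
          content R f ^ (n + 1) * content R h := by
        calc _ ≤ Submodule.span R {a} * (content R f ^ n * content R (f * g')) :=
              mul_mono_right (ihn f g' hg'deg)
          _ = content R f ^ n * (Submodule.span R {a} * content R (f * g')) := by ring
          _ ≤ content R f ^ n * (content R f * content R h) := mul_mono_right h₁
          _ = _ := by ring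
      have h₃ : Submodule.span R {a} * (content R f ^ (n + 1) * content R g) ≤
          content R f ^ (n + 1) * content R h := by
        have hgle : content R g ≤ content R g' + Submodule.span R {b} := content_le.2 fun N => by
          rw [Submodule.add_eq_sup]
          by_cases hN : N = n + 1
          · rw [hN]; exact Submodule.mem_sup_right (Submodule.mem_span_singleton_self _)
          · refine Submodule.mem_sup_left ?_
            have : g.coeff N = g'.coeff N := by simp [hg', coeff_X_pow, hN]
            rw [this]; exact coeff_mem_content _ _
        calc _ ≤ Submodule.span R {a} * (content R f ^ (n + 1) *
                (content R g' + Submodule.span R {b})) :=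
              mul_mono_right (mul_mono_right hgle)
          _ = Submodule.span R {a} * (content R f ^ (n + 1) * content R g') +
              content R f ^ (n + 1) * (Submodule.span R {a} * Submodule.span R {b}) := by ring
          _ ≤ content R f ^ (n + 1) * content R h := by
            rw [Submodule.add_eq_sup]
            refine sup_le h₂ (mul_mono_right ?_)
            rw [Submodule.span_mul_span, Set.singleton_mul_singleton, Submodule.span_le,
              Set.singleton_subset_iff]
            exact hab
      refine pow_succ_mul_le_of_le_sup (content_le_sup_eraseLead f) (content_eraseLead_le f) h₃ ?_
      have hs := ihs f' (by rw [card_support_eraseLead, hf]; rfl)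
      refine hs.trans ?_
      have hf'g : content R (f' * g) ≤ content R h + Submodule.span R {a} * content R g := by
        have : f' * g = h - X ^ m * (C a * g) := by
          have := f.eraseLead_add_C_mul_X_pow
          calc f' * g = (f' + C a * X ^ m) * g - X ^ m * (C a * g) := by ring
            _ = _ := by rw [this]
        rw [this, Submodule.add_eq_sup, ← content_C_mul]
        exact (content_sub_le _ _).trans (sup_le_sup_left (content_X_pow_mul_le _ _) _)
      calc _ ≤ content R f ^ (n + 1) * (content R h + Submodule.span R {a} * content R g) :=
            mul_le_mul' (pow_le_pow_left' (content_eraseLead_le f) _) hf'g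
        _ = content R f ^ (n + 1) * content R h +
            Submodule.span R {a} * (content R f ^ (n + 1) * content R g) := by ring
        _ ≤ _ := by
          rw [Submodule.add_eq_sup]
          exact sup_le le_rfl h₃

theorem isIntegral_of_mul_mem_of_fg {N : Submodule R S} (hN : N.FG) (h1 : (1 : S) ∈ N) {z : S}
    (hz : ∀ x ∈ N, z * x ∈ N) : IsIntegral R z := by
  have : Module.Finite R N := Module.Finite.iff_fg.2 hN
  let φ : Module.End R N := (LinearMap.mulLeft R z).restrict hz
  obtain ⟨p, hp, hpφ⟩ := (Algebra.IsIntegral.isIntegral φ : IsIntegral R φ)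
  refine ⟨p, hp, ?_⟩
  have key : ∀ q : R[X], ((aeval φ q) ⟨1, h1⟩ : S) = aeval z q := fun q => by
    induction q using Polynomial.induction_on' with
    | add p q hp hq => simp [hp, hq]
    | monomial n a =>
      have : ∀ n : ℕ, ((φ ^ n) ⟨1, h1⟩ : S) = z ^ n := fun n => by
        induction n with
        | zero => simp
        | succ n ih => rw [pow_succ', Module.End.mul_apply, pow_succ', ← ih]; rfl
      simp [aeval_monomial, this, Algebra.smul_def]
  rw [← aeval_def] at hpφ ⊢
  rw [← key, hpφ]
  rfl

/-- Kronecker's theorem: if `fg` has coefficients in `R` then the products of a coefficient of `f`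
and a coefficient of `g` are integral over `R`. -/
theorem isIntegral_coeff_mul_coeff {f g : S[X]} (h : ∀ n, (f * g).coeff n ∈ (1 : Submodule R S))
    (i j : ℕ) : IsIntegral R (f.coeff i * g.coeff j) := by
  set n := g.natDegree
  set P := content R f
  set Q := content R g
  have hPQ : P ^ (n + 1) * Q ≤ P ^ n := by
    refine (content_pow_mul_content_le n f g le_rfl).trans ?_
    calc _ ≤ P ^ n * 1 := mul_mono_right (content_le.2 h)
      _ = P ^ n := mul_one _
  have hmem : f.coeff i * g.coeff j ∈ P * Q :=
    Submodule.mul_mem_mul (coeff_mem_content _ _) (coeff_mem_content _ _)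
  -- By `hpow`, `N` is stable under `P * Q`. It is finitely generated and contains `1`, so the
  -- determinant trick makes every element of `P * Q` integral.
  set N := (1 + P * Q) ^ n
  have h1 : (1 : Submodule R S) ≤ 1 + P * Q := by
    rw [Submodule.add_eq_sup]; exact le_sup_left
  have hN1 : (1 : S) ∈ N := by
    have : (1 : Submodule R S) ≤ N := one_le_pow_of_one_le' h1 n
    exact this (Submodule.one_le.1 le_rfl)
  have hpow : (P * Q) ^ (n + 1) ≤ (P * Q) ^ n := by
    calc (P * Q) ^ (n + 1) = (P ^ (n + 1) * Q) * Q ^ n := by ring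
      _ ≤ P ^ n * Q ^ n := mul_mono_left hPQ
      _ = (P * Q) ^ n := by ring
  have hN : P * Q * N ≤ N := by
    have : ∀ j ≤ n, (P * Q) ^ (n - j) * (P * Q) * (1 + P * Q) ^ j ≤
        (P * Q) ^ (n - j) * (1 + P * Q) ^ j := by
      intro j hj
      induction j with
      | zero => simpa [← pow_succ] using hpow
      | succ j ih =>
        obtain ⟨m, hm⟩ : ∃ m, n = m + j + 1 := ⟨n - (j + 1), by omega⟩
        have e₁ : n - (j + 1) = m := by omega
        have e₂ : n - j = m + 1 := by omega
        have ih := ih (by omega)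
        rw [e₂] at ih
        rw [e₁]
        calc (P * Q) ^ m * (P * Q) * (1 + P * Q) ^ (j + 1)
            = (P * Q) ^ (m + 1) * (1 + P * Q) ^ j +
              (P * Q) ^ (m + 1) * (P * Q) * (1 + P * Q) ^ j := by ring
          _ ≤ (P * Q) ^ (m + 1) * (1 + P * Q) ^ j := by
            rw [Submodule.add_eq_sup]
            exact sup_le le_rfl ih
          _ = (P * Q) ^ m * ((P * Q) * (1 + P * Q) ^ j) := by ring
          _ ≤ (P * Q) ^ m * ((1 + P * Q) * (1 + P * Q) ^ j) :=
            mul_mono_right (mul_mono_left (by rw [Submodule.add_eq_sup]; exact le_sup_right))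
          _ = (P * Q) ^ m * (1 + P * Q) ^ (j + 1) := by ring
    simpa [N] using this n le_rfl
  have hNfg : N.FG := by
    refine Submodule.FG.pow ?_ n
    rw [Submodule.add_eq_sup]
    exact Submodule.FG.sup (Submodule.one_eq_span (R := R) (A := S) ▸ Submodule.fg_span_singleton 1)
      ((content_fg f).mul (content_fg g))
  exact isIntegral_of_mul_mem_of_fg hNfg hN1 fun x hx => hN (Submodule.mul_mem_mul hmem hx)

end DedekindMertens

/-! ### Normalized systems in one variable over a subintegrally closed ring. -/

section Polynomial

open Polynomial

/-- Generators `x` and `y` of mutually inverse `R[X]`-submodules of `S[X]` which become trivial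
at `X = 0`. -/
structure IsNormalizedSystem (R : Type*) {S : Type*} [CommRing R] [CommRing S] [Algebra R S]
    {ι : Type*} [Fintype ι] (x y : ι → S[X]) : Prop where
  sum_eq : ∑ i, x i * y i = 1
  coeff_mul : ∀ i j n, (x i * y j).coeff n ∈ (algebraMap R S).range
  coeff_zero_left : ∀ i, (x i).coeff 0 ∈ (algebraMap R S).range
  coeff_zero_right : ∀ i, (y i).coeff 0 ∈ (algebraMap R S).range

namespace IsNormalizedSystem

variable {R S : Type*} [CommRing R] [CommRing S] [Algebra R S] {ι : Type*} [Fintype ι]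
  {x y : ι → S[X]}

theorem swap (h : IsNormalizedSystem R x y) : IsNormalizedSystem R y x where
  sum_eq := by rw [← h.sum_eq]; exact Finset.sum_congr rfl fun _ _ => mul_comm _ _
  coeff_mul i j n := by rw [mul_comm]; exact h.coeff_mul j i n
  coeff_zero_left := h.coeff_zero_right
  coeff_zero_right := h.coeff_zero_left

theorem map (h : IsNormalizedSystem R x y) {R' S' : Type*} [CommRing R'] [CommRing S']
    [Algebra R' S'] (f : S →+* S') (hf : IsPairHom R R' f) :
    IsNormalizedSystem R' (fun i => (x i).map f) (fun i => (y i).map f) where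
  sum_eq := by
    simp only [← Polynomial.map_mul, ← Polynomial.map_sum, h.sum_eq, Polynomial.map_one]
  coeff_mul i j n := by
    rw [← Polynomial.map_mul, coeff_map]
    obtain ⟨r, hr⟩ := h.coeff_mul i j n
    rw [← hr]; exact hf r
  coeff_zero_left i := by
    rw [coeff_map]
    obtain ⟨r, hr⟩ := h.coeff_zero_left i
    rw [← hr]; exact hf r
  coeff_zero_right i := by
    rw [coeff_map]
    obtain ⟨r, hr⟩ := h.coeff_zero_right i
    rw [← hr]; exact hf r

/-- As `k[X]` has trivial Picard group, the `x i` span a module generated by a unit of `L[X]`, which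
is a constant `c` because `L` is reduced. Not all constant terms of the `x i` vanish, and they lie
in `k`; hence so does `c`. -/
theorem coeff_mem_of_field {k L : Type*} [Field k] [CommRing L] [IsReduced L] [Nontrivial L]
    [Algebra k L] {x y : ι → L[X]} (h : IsNormalizedSystem k x y) (i : ι) (n : ℕ) :
    (x i).coeff n ∈ (algebraMap k L).range := by
  let _ : Algebra k[X] L[X] := Polynomial.algebra k L
  have hinj : Function.Injective (algebraMap k[X] L[X]) := by
    exact Polynomial.map_injective _ (algebraMap k L).injective
  have : FaithfulSMul k[X] L[X] := (faithfulSMul_iff_algebraMap_injective _ _).2 hinj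
  let I := Submodule.span k[X] (Set.range x)
  let J := Submodule.span k[X] (Set.range y)
  have hIJ : I * J = 1 := by
    refine le_antisymm ?_ ?_
    · rw [Submodule.span_mul_span, Submodule.span_le]
      rintro _ ⟨_, ⟨i, rfl⟩, _, ⟨j, rfl⟩, rfl⟩
      have : x i * y j ∈ lifts (algebraMap k L) :=
        (lifts_iff_coeff_lifts _).2 fun n => h.coeff_mul i j n
      obtain ⟨q, hq⟩ := this
      exact Submodule.mem_one.2 ⟨q, hq⟩
    · rw [Submodule.one_le, ← h.sum_eq]
      exact sum_mem fun i _ => Submodule.mul_mem_mul (Submodule.subset_span ⟨i, rfl⟩)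
        (Submodule.subset_span ⟨i, rfl⟩)
  let U : (Submodule k[X] L[X])ˣ := ⟨I, J, hIJ, by rw [mul_comm, hIJ]⟩
  have hU : U ∈ (Submodule.unitsToPic k[X] L[X]).ker := Subsingleton.elim _ _
  rw [Submodule.ker_unitsToPic] at hU
  obtain ⟨u, hu⟩ := hU
  have hu : Submodule.span k[X] {(u : L[X])} = I := congrArg Units.val hu
  obtain ⟨c, hcu⟩ : ∃ c : L, C c = (u : L[X]) := by
    refine ⟨(u : L[X]).coeff 0, Polynomial.ext fun n => ?_⟩
    rw [coeff_C]
    split_ifs with hn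
    · rw [hn]
    · exact (((coeff_isUnit_isNilpotent_of_isUnit u.isUnit).2 n hn).eq_zero).symm
  have hx : ∀ i, ∃ q : k[X], x i = q.map (algebraMap k L) * C c := fun i => by
    have : x i ∈ I := Submodule.subset_span ⟨i, rfl⟩
    rw [← hu, ← hcu] at this
    obtain ⟨q, hq⟩ := Submodule.mem_span_singleton.1 this
    exact ⟨q, by rw [← hq, Algebra.smul_def]; rfl⟩
  choose q hq using hx
  have hne : ∃ j, (q j).coeff 0 ≠ 0 := by
    by_contra! hne
    have h0 := congrArg (fun f => coeff f 0) h.sum_eq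
    simp [hq, hne, mul_coeff_zero] at h0
  obtain ⟨j, hj⟩ := hne
  have hcmem : c ∈ (algebraMap k L).range := by
    obtain ⟨r, hr⟩ := h.coeff_zero_left j
    refine ⟨((q j).coeff 0)⁻¹ * r, ?_⟩
    rw [map_mul, hr, hq, coeff_mul_C, coeff_map, ← mul_assoc, ← map_mul, inv_mul_cancel₀ hj,
      map_one, one_mul]
  rw [hq, coeff_mul_C, coeff_map]
  exact mul_mem ⟨_, rfl⟩ hcmem

/-- A reduced ring localized at a minimal prime is a field. Inverting the complement of `p` in both
rings reduces to the field case, and `s` is the product of the denominators. -/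
theorem exists_mul_coeff_mem_of_minimalPrimes [IsReduced S] {R : Subring S} {x y : ι → S[X]}
    (h : IsNormalizedSystem R x y) {p : Ideal R} (hp : p ∈ minimalPrimes R) (i : ι) (n : ℕ) :
    ∃ s : R, s ∉ p ∧ s * (x i).coeff n ∈ R := by
  have hpp : p.IsPrime := hp.1.1
  have : IsReduced R := isReduced_of_injective R.subtype R.subtype_injective
  let k := Localization.AtPrime p
  have : Ring.KrullDimLE 0 k := .of_isLocalization _ hp _
  let _ : Field k := Ring.KrullDimLE.isField_of_isReduced.toField
  let M := Algebra.algebraMapSubmonoid S p.primeCompl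
  let L := Localization M
  have hM : ∀ r : R, r ∉ p → (r : S) ∈ M := fun r hr => ⟨r, hr, rfl⟩
  have h0 : (0 : S) ∉ M := by
    rintro ⟨r, hr, hr0⟩
    have : r = 0 := Subtype.ext hr0
    exact hr (this ▸ p.zero_mem)
  have : Nontrivial L := not_subsingleton_iff_nontrivial.1 fun hs =>
    h0 ((IsLocalization.subsingleton_iff (M := M)).1 hs)
  have : IsReduced L := inferInstance
  have hunit : ∀ r : p.primeCompl, IsUnit (((algebraMap S L).comp (algebraMap R S)) r) := fun r =>
    IsLocalization.map_units L (⟨_, hM r r.2⟩ : M)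
  let φ : k →+* L := IsLocalization.lift hunit
  have hφ : ∀ r : R, φ (algebraMap R k r) = algebraMap S L r :=
    fun r => IsLocalization.lift_eq hunit r
  let _ : Algebra k L := φ.toAlgebra
  have hL := (h.map (R' := k) (algebraMap S L)
    fun r => ⟨algebraMap R k r, hφ r⟩).coeff_mem_of_field i n
  rw [coeff_map] at hL
  obtain ⟨z, hz⟩ := hL
  obtain ⟨r, s, rfl⟩ := IsLocalization.exists_mk'_eq p.primeCompl z
  have : algebraMap S L ((s : R) * (x i).coeff n) = algebraMap S L r := by
    rw [map_mul, ← hz, ← hφ, ← hφ]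
    change φ _ * φ _ = _
    rw [← map_mul, IsLocalization.mk'_spec']
  obtain ⟨⟨_, t, ht, rfl⟩, hts⟩ := (IsLocalization.eq_iff_exists M L).1 this
  refine ⟨t * s, fun hmem => (hpp.mem_or_mem hmem).elim ht s.2, ?_⟩
  have hts : (t : S) * ((s : R) * (x i).coeff n) = t * r := hts
  rw [Subring.coe_mul, mul_assoc, hts]
  exact mul_mem t.2 r.2

/-- The conductor of `R` in `S`. -/
def conductor (R S : Type*) [CommRing R] [CommRing S] [Algebra R S] : Ideal S where
  carrier := {s | ∀ a, s * a ∈ (algebraMap R S).range}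
  add_mem' hs ht a := by rw [add_mul]; exact add_mem (hs a) (ht a)
  zero_mem' a := by rw [zero_mul]; exact zero_mem _
  smul_mem' c s hs a := by
    rw [smul_eq_mul, show c * s * a = s * (c * a) by ring]
    exact hs _

/-- If `s ^ 2` is in the conductor, then `(s * a) ^ 2` and `(s * a) ^ 3` lie in `R` for every `a`,
hence so does `s * a`. -/
theorem conductor_isRadical
    (hcl : ∀ b : S, b ^ 2 ∈ (algebraMap R S).range → b ^ 3 ∈ (algebraMap R S).range →
      b ∈ (algebraMap R S).range) : (conductor R S).IsRadical := by
  rw [Ideal.isRadical_iff_pow_one_lt 2 one_lt_two]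
  intro s hs a
  refine hcl _ ?_ ?_
  · rw [mul_pow]; exact hs _
  · rw [show (s * a) ^ 3 = s ^ 2 * (s * a ^ 3) by ring]; exact hs _

/-- If the conductor `I` is proper, `S ⧸ I` is reduced and nonzero. At a minimal prime of the image
of `R`, every generator of `S` is carried into `R` by some `s` outside the prime. Finiteness gives
one `s` with `s S ⊂ R`, that is, `s ∈ I`; but then the image of `s` is `0`, which lies in the prime.
-/
theorem coeff_mem_of_finite [Module.Finite R S] (h : IsNormalizedSystem R x y)
    (hcl : ∀ b : S, b ^ 2 ∈ (algebraMap R S).range → b ^ 3 ∈ (algebraMap R S).range →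
      b ∈ (algebraMap R S).range)
    (hgen : Algebra.adjoin R {a | ∃ i n, a = (x i).coeff n ∨ a = (y i).coeff n} = ⊤)
    (a : S) : a ∈ (algebraMap R S).range := by
  set I := conductor R S
  by_cases hI : I = ⊤
  · have : (1 : S) ∈ I := by rw [hI]; trivial
    simpa using this a
  exfalso
  have : Nontrivial (S ⧸ I) := Ideal.Quotient.nontrivial_iff.2 hI
  have : IsReduced (S ⧸ I) := (Ideal.isRadical_iff_quotient_reduced I).1 (conductor_isRadical hcl)
  let f : R →+* S ⧸ I := (Ideal.Quotient.mk I).comp (algebraMap R S)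
  obtain ⟨p, hp⟩ := Ideal.nonempty_minimalPrimes (I := (⊥ : Ideal f.range)) bot_ne_top
  have hp : p ∈ minimalPrimes f.range := hp
  have hpp : p.IsPrime := hp.1.1
  set q : Ideal R := p.comap f.rangeRestrict
  have hqp : q.IsPrime := Ideal.IsPrime.comap _
  have hq : IsPairHom R f.range (Ideal.Quotient.mk I) := fun r => ⟨f.rangeRestrict r, rfl⟩
  let T : Subalgebra R S :=
    { carrier := {a | ∃ s, s ∉ q ∧ algebraMap R S s * a ∈ (algebraMap R S).range}
      mul_mem' := by
        rintro a b ⟨s, hs, hsa⟩ ⟨t, ht, htb⟩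
        refine ⟨s * t, hqp.mul_notMem hs ht, ?_⟩
        rw [map_mul, mul_mul_mul_comm]
        exact mul_mem hsa htb
      add_mem' := by
        rintro a b ⟨s, hs, hsa⟩ ⟨t, ht, htb⟩
        refine ⟨s * t, hqp.mul_notMem hs ht, ?_⟩
        rw [map_mul, show algebraMap R S s * algebraMap R S t * (a + b) =
          algebraMap R S t * (algebraMap R S s * a) +
            algebraMap R S s * (algebraMap R S t * b) by ring]
        exact add_mem (mul_mem ⟨_, rfl⟩ hsa) (mul_mem ⟨_, rfl⟩ htb)
      algebraMap_mem' := fun r => ⟨1, hqp.one_notMem, by rw [map_one, one_mul]; exact ⟨r, rfl⟩⟩ }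
  have hlift : ∀ a : S, (∃ s : f.range, s ∉ p ∧ s * Ideal.Quotient.mk I a ∈ f.range) → a ∈ T := by
    rintro a ⟨⟨_, s, rfl⟩, hs, r, hr⟩
    -- A congruence modulo `I` suffices because the conductor is itself contained in `R`.
    refine ⟨s, hs, ?_⟩
    have hr : Ideal.Quotient.mk I (algebraMap R S r) =
        Ideal.Quotient.mk I (algebraMap R S s * a) := by
      rw [map_mul]; exact hr
    have := Ideal.Quotient.eq.1 hr 1
    rw [mul_one] at this
    have := sub_mem (⟨r, rfl⟩ : algebraMap R S r ∈ (algebraMap R S).range) this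
    rwa [sub_sub_cancel] at this
  have hT : T = ⊤ := by
    rw [eq_top_iff, ← hgen, Algebra.adjoin_le_iff]
    rintro _ ⟨i, n, rfl | rfl⟩
    · have := (h.map _ hq).exists_mul_coeff_mem_of_minimalPrimes hp i n
      rw [coeff_map] at this
      exact hlift _ this
    · have := (h.map _ hq).swap.exists_mul_coeff_mem_of_minimalPrimes hp i n
      rw [coeff_map] at this
      exact hlift _ this
  obtain ⟨t, ht⟩ := Module.Finite.fg_top (R := R) (M := S)
  have hfin : ∀ t : Finset S, ∃ s, s ∉ q ∧
      ∀ a ∈ t, algebraMap R S s * a ∈ (algebraMap R S).range := by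
    classical
    intro t
    induction t using Finset.induction_on with
    | empty => exact ⟨1, hqp.one_notMem, by simp⟩
    | insert a t _ ih =>
      obtain ⟨s, hs, hst⟩ := ih
      obtain ⟨s', hs', hsa⟩ : a ∈ T := by rw [hT]; trivial
      refine ⟨s * s', hqp.mul_notMem hs hs', fun b hb => ?_⟩
      rw [map_mul]
      rcases Finset.mem_insert.1 hb with rfl | hb
      · rw [mul_assoc]
        exact mul_mem ⟨_, rfl⟩ hsa
      · rw [mul_comm (algebraMap R S s), mul_assoc]
        exact mul_mem ⟨_, rfl⟩ (hst b hb)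
  obtain ⟨s, hs, hst⟩ := hfin t
  refine hs ?_
  have hsI : algebraMap R S s ∈ I := fun a => by
    have ha : a ∈ Submodule.span R (t : Set S) := by rw [ht]; trivial
    induction ha using Submodule.span_induction with
    | mem a ha => exact hst a ha
    | zero => rw [mul_zero]; exact zero_mem _
    | add a b _ _ ha hb => rw [mul_add]; exact add_mem ha hb
    | smul r a _ ha =>
      rw [Algebra.smul_def, mul_left_comm]
      exact mul_mem ⟨_, rfl⟩ ha
  have : f.rangeRestrict s = 0 := Subtype.ext (Ideal.Quotient.eq_zero_iff_mem.2 hsI)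
  change f.rangeRestrict s ∈ p
  rw [this]
  exact p.zero_mem

/-- Kronecker's theorem controls only products of a coefficient of `x i` and one of `y j`. Setting
`X = 0` in `∑ x j * y j = 1` expresses a coefficient of `x i` through such products and the constant
terms `(x j).coeff 0`, which lie in `R`. -/
theorem isIntegral_coeff (h : IsNormalizedSystem R x y) (i : ι) (n : ℕ) :
    IsIntegral R ((x i).coeff n) := by
  have h0 : ∑ j, (x j).coeff 0 * (y j).coeff 0 = 1 := by
    have := congrArg (fun f => coeff f 0) h.sum_eq
    simpa [finsetSum_coeff, mul_coeff_zero] using this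
  have : (x i).coeff n = ∑ j, (x i).coeff n * (y j).coeff 0 * (x j).coeff 0 := by
    calc (x i).coeff n = (x i).coeff n * ∑ j, (x j).coeff 0 * (y j).coeff 0 := by rw [h0, mul_one]
      _ = _ := by rw [Finset.mul_sum]; exact Finset.sum_congr rfl fun _ _ => by ring
  rw [this]
  refine IsIntegral.sum _ fun j _ => IsIntegral.mul ?_ ?_
  · refine isIntegral_coeff_mul_coeff (fun m => ?_) n 0
    obtain ⟨r, hr⟩ := h.coeff_mul i j m
    exact Submodule.mem_one.2 ⟨r, hr⟩
  · obtain ⟨r, hr⟩ := h.coeff_zero_left j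
    rw [← hr]
    exact isIntegral_algebraMap

/-- If `R` is subintegrally closed in `S`, every normalized system has coefficients in `R`. -/
theorem coeff_mem (h : IsNormalizedSystem R x y)
    (hcl : ∀ b : S, b ^ 2 ∈ (algebraMap R S).range → b ^ 3 ∈ (algebraMap R S).range →
      b ∈ (algebraMap R S).range) (i : ι) (n : ℕ) : (x i).coeff n ∈ (algebraMap R S).range := by
  set s : Set S := {a | ∃ i n, a = (x i).coeff n ∨ a = (y i).coeff n} with hs
  have hsfin : s.Finite := by
    have : s ⊆ insert 0 (⋃ i, ((x i).coeffs ∪ (y i).coeffs : Set S)) := by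
      rintro _ ⟨i, n, rfl | rfl⟩
      · by_cases h0 : (x i).coeff n = 0
        · exact Or.inl h0
        · exact Or.inr (Set.mem_iUnion.2 ⟨i, Or.inl (coeff_mem_coeffs h0)⟩)
      · by_cases h0 : (y i).coeff n = 0
        · exact Or.inl h0
        · exact Or.inr (Set.mem_iUnion.2 ⟨i, Or.inr (coeff_mem_coeffs h0)⟩)
    exact (Set.Finite.insert _ (Set.finite_iUnion fun i =>
      (Finset.finite_toSet _).union (Finset.finite_toSet _))).subset this
  -- Integrality of the finitely many coefficients makes `E` finite over `R`, and the whole system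
  -- already lives over `E`.
  let E := Algebra.adjoin R s
  have hfg : E.toSubmodule.FG := fg_adjoin_of_finite hsfin (by
    rintro _ ⟨i, n, rfl | rfl⟩
    · exact h.isIntegral_coeff i n
    · exact h.swap.isIntegral_coeff i n)
  have : Module.Finite R E := Module.Finite.iff_fg.2 hfg
  have hx : ∀ i, ∃ f : E[X], f.map (algebraMap E S) = x i := fun i =>
    (lifts_iff_coeff_lifts _).2 fun n => ⟨⟨_, Algebra.subset_adjoin ⟨i, n, Or.inl rfl⟩⟩, rfl⟩
  have hy : ∀ i, ∃ f : E[X], f.map (algebraMap E S) = y i := fun i =>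
    (lifts_iff_coeff_lifts _).2 fun n => ⟨⟨_, Algebra.subset_adjoin ⟨i, n, Or.inr rfl⟩⟩, rfl⟩
  choose x' hx' using hx
  choose y' hy' using hy
  have hE : ∀ {a : E}, (a : S) ∈ (algebraMap R S).range → a ∈ (algebraMap R E).range := by
    rintro a ⟨r, hr⟩
    exact ⟨r, Subtype.ext hr⟩
  have hE' : ∀ {a : E}, a ∈ (algebraMap R E).range → (a : S) ∈ (algebraMap R S).range := by
    rintro a ⟨r, rfl⟩
    exact ⟨r, rfl⟩
  have hcx : ∀ i n, (((x' i).coeff n : E) : S) = (x i).coeff n := fun i n => by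
    rw [← hx', coeff_map]; rfl
  have hcy : ∀ i n, (((y' i).coeff n : E) : S) = (y i).coeff n := fun i n => by
    rw [← hy', coeff_map]; rfl
  have h' : IsNormalizedSystem R x' y' :=
    { sum_eq := by
        apply Polynomial.map_injective (algebraMap E S) Subtype.val_injective
        rw [Polynomial.map_sum, Polynomial.map_one, ← h.sum_eq]
        exact Finset.sum_congr rfl fun i _ => by rw [Polynomial.map_mul, hx', hy']
      coeff_mul := fun i j n => hE (by
        have : (((x' i * y' j).coeff n : E) : S) = (x i * y j).coeff n := by
          rw [← hx', ← hy', ← Polynomial.map_mul, coeff_map]; rfl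
        rw [this]
        exact h.coeff_mul i j n)
      coeff_zero_left := fun i => hE (by rw [hcx]; exact h.coeff_zero_left i)
      coeff_zero_right := fun i => hE (by rw [hcy]; exact h.coeff_zero_right i) }
  rw [← hcx]
  refine hE' (h'.coeff_mem_of_finite (fun b h2 h3 => hE (hcl _ ?_ ?_)) ?_ _)
  · simpa using hE' h2
  · simpa using hE' h3
  · have : (E.val '' {a : E | ∃ i n, a = (x' i).coeff n ∨ a = (y' i).coeff n}) = s := by
      ext a
      constructor
      · rintro ⟨_, ⟨i, n, rfl | rfl⟩, rfl⟩
        · exact ⟨i, n, Or.inl (hcx i n)⟩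
        · exact ⟨i, n, Or.inr (hcy i n)⟩
      · rintro ⟨i, n, rfl | rfl⟩
        · exact ⟨_, ⟨i, n, Or.inl rfl⟩, hcx i n⟩
        · exact ⟨_, ⟨i, n, Or.inr rfl⟩, hcy i n⟩
    apply Subalgebra.map_injective (f := E.val) Subtype.val_injective
    rw [AlgHom.map_adjoin, this, Algebra.map_top, Subalgebra.range_val]

end IsNormalizedSystem

end Polynomial

/-! ### Gordan's theorem and weights on positive monoids. -/

section Gordan

open Filter

/-- An element of infinite order spans a copy of `ℤ`, and `ℤ → ℚ` extends to `G` because `ℚ` is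
divisible, hence injective. -/
theorem exists_addMonoidHom_eq_one {G : Type*} [AddCommGroup G] {g : G}
    (hg : ∀ n : ℕ, n • g = 0 → n = 0) : ∃ η : G →+ ℚ, η g = 1 := by
  have hinj : Function.Injective (zmultiplesHom G g) := by
    rw [injective_iff_map_eq_zero]
    intro n hn
    rw [zmultiplesHom_apply] at hn
    obtain ⟨m, rfl | rfl⟩ := n.eq_nat_or_neg
    · rw [natCast_zsmul] at hn; simp [hg m hn]
    · rw [neg_smul, natCast_zsmul, neg_eq_zero] at hn; simp [hg m hn]
  obtain ⟨η, hη⟩ := (Module.Baer.of_divisible ℚ).extension_property_addMonoidHom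
    (zmultiplesHom G g) hinj (Int.castAddHom ℚ)
  refine ⟨η, ?_⟩
  have := DFunLike.congr_fun hη 1
  simpa using this

theorem eventually_pos_mul_add {a : ℚ} (ha : 0 < a) (b : ℚ) : ∀ᶠ N : ℕ in atTop, 0 < N * a + b := by
  obtain ⟨k, hk⟩ := exists_nat_gt (-b / a)
  filter_upwards [eventually_ge_atTop k] with N hN
  have : -b / a < N := hk.trans_le (by exact_mod_cast hN)
  rw [div_lt_iff₀ ha] at this
  linarith

theorem eventually_ne_mul_add {a : ℚ} (ha : a ≠ 0) (b : ℚ) : ∀ᶠ N : ℕ in atTop, N * a + b ≠ 0 := by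
  rcases ha.lt_or_gt with ha | ha
  · filter_upwards [eventually_pos_mul_add (neg_pos.2 ha) (-b)] with N hN h
    linarith
  · filter_upwards [eventually_pos_mul_add ha b] with N hN using hN.ne'

/-- Gordan's theorem: finitely many elements of an abelian group without nontrivial relation with
nonnegative coefficients lie in an open half space. -/
theorem exists_addMonoidHom_pos {ι : Type*} {G : Type u} [AddCommGroup G] (s : Finset ι) (v : ι → G)
    (H : ∀ n : ι → ℕ, ∑ i ∈ s, n i • v i = 0 → ∀ i ∈ s, n i = 0) :
    ∃ φ : G →+ ℚ, ∀ i ∈ s, 0 < φ (v i) := by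
  classical
  induction s using Finset.induction_on generalizing G with
  | empty => exact ⟨0, by simp⟩
  | insert t s hts ih =>
    have H₁ : ∀ (c : ℕ) (n : ι → ℕ), c • v t + ∑ i ∈ s, n i • v i = 0 →
        c = 0 ∧ ∀ i ∈ s, n i = 0 := by
      intro c n hcn
      have hne : ∀ i ∈ s, i ≠ t := fun i hi h => hts (h ▸ hi)
      have := H (Function.update n t c) (by
        rw [Finset.sum_insert hts, Function.update_self, ← hcn]
        congr 1
        exact Finset.sum_congr rfl fun i hi => by rw [Function.update_of_ne (hne i hi)])
      refine ⟨by simpa using this t (Finset.mem_insert_self _ _), fun i hi => ?_⟩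
      simpa [Function.update_of_ne (hne i hi)] using this i (Finset.mem_insert_of_mem hi)
    -- If a multiple of `v t` lies in the cone over `s`, a functional positive on `s` is positive on
    -- `v t`. Otherwise the hypothesis passes to the quotient by `v t`; a functional `ψ` from there
    -- vanishes on `v t`, and a large multiple of it is corrected by `η` with `η (v t) = 1`.
    by_cases hc : ∃ (c : ℕ) (n : ι → ℕ), 0 < c ∧ c • v t = ∑ i ∈ s, n i • v i
    · obtain ⟨c, n, hc, hcn⟩ := hc
      obtain ⟨φ, hφ⟩ := ih v fun n hn => (H₁ 0 n (by rw [zero_smul, zero_add, hn])).2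
      refine ⟨φ, fun i hi => ?_⟩
      rcases Finset.mem_insert.1 hi with rfl | hi
      · have hpos : ∃ j ∈ s, 0 < n j := by
          by_contra! hn
          have h0 : c • v i = 0 := by
            rw [hcn]
            exact Finset.sum_eq_zero fun j hj => by rw [Nat.le_zero.1 (hn j hj), zero_smul]
          have := (H₁ c (fun _ => 0) (by simp [h0])).1
          omega
        obtain ⟨j, hj, hnj⟩ := hpos
        have h := congrArg φ hcn
        rw [map_nsmul, map_sum, nsmul_eq_mul] at h
        have : 0 < ∑ i ∈ s, φ (n i • v i) := by
          refine Finset.sum_pos' (fun i hi => ?_) ⟨j, hj, ?_⟩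
          · rw [map_nsmul]; exact nsmul_nonneg (hφ i hi).le _
          · rw [map_nsmul, nsmul_eq_mul]
            exact mul_pos (by exact_mod_cast hnj) (hφ j hj)
        rw [← h] at this
        exact (mul_pos_iff_of_pos_left (by exact_mod_cast hc)).1 this
      · exact hφ i hi
    · let K := AddSubgroup.zmultiples (v t)
      obtain ⟨ψ, hψ⟩ := ih (G := G ⧸ K) (fun i => (v i : G ⧸ K)) fun n hn => by
        have : ((∑ i ∈ s, n i • v i : G) : G ⧸ K) = 0 := by
          rw [← hn]
          exact (map_sum (QuotientAddGroup.mk' K) _ _)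
        rw [QuotientAddGroup.eq_zero_iff] at this
        obtain ⟨c, hcn⟩ := AddSubgroup.mem_zmultiples_iff.1 this
        obtain ⟨m, rfl | rfl⟩ := c.eq_nat_or_neg
        · rw [natCast_zsmul] at hcn
          rcases Nat.eq_zero_or_pos m with rfl | hm
          · exact (H₁ 0 n (by rw [zero_smul, zero_add, ← hcn, zero_smul])).2
          · exact absurd ⟨m, n, hm, hcn⟩ hc
        · rw [neg_smul, natCast_zsmul] at hcn
          exact (H₁ m n (by rw [← hcn, add_neg_cancel])).2
      obtain ⟨η, hη⟩ := exists_addMonoidHom_eq_one (g := v t) fun n hn =>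
        (H₁ n (fun _ => 0) (by simp [hn])).1
      have hev : ∀ᶠ N : ℕ in atTop, ∀ i ∈ s, 0 < N * ψ (v i) + η (v i) :=
        (Filter.eventually_all_finset s).2 fun i hi => eventually_pos_mul_add (hψ i hi) _
      obtain ⟨N, hN⟩ := hev.exists
      refine ⟨N • ψ.comp (QuotientAddGroup.mk' K) + η, fun i hi => ?_⟩
      rcases Finset.mem_insert.1 hi with rfl | hi
      · have : ((v i : G) : G ⧸ K) = 0 :=
          (QuotientAddGroup.eq_zero_iff _).2 (AddSubgroup.mem_zmultiples _)
        simp [this, hη]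
      · simpa using hN i hi

/-- A functional that vanishes on a new `w a` is replaced by `N φ + η` with `η (w a) = 1`; large `N`
preserves the finitely many earlier conditions. Applied to differences of monomials, this makes the
weights distinct. -/
theorem exists_addMonoidHom_pos_of_ne {ι κ : Type*} {G : Type u} [AddCommGroup G] (s : Finset ι)
    (v : ι → G) (H : ∀ n : ι → ℕ, ∑ i ∈ s, n i • v i = 0 → ∀ i ∈ s, n i = 0) (t : Finset κ)
    (w : κ → G) (hw : ∀ j ∈ t, ∀ n : ℕ, n • w j = 0 → n = 0) :
    ∃ φ : G →+ ℚ, (∀ i ∈ s, 0 < φ (v i)) ∧ ∀ j ∈ t, φ (w j) ≠ 0 := by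
  classical
  induction t using Finset.induction_on with
  | empty =>
    obtain ⟨φ, hφ⟩ := exists_addMonoidHom_pos s v H
    exact ⟨φ, hφ, by simp⟩
  | insert a t _ ih =>
    obtain ⟨φ, hφ, hφt⟩ := ih fun j hj => hw j (Finset.mem_insert_of_mem hj)
    by_cases ha : φ (w a) = 0
    · obtain ⟨η, hη⟩ := exists_addMonoidHom_eq_one (hw a (Finset.mem_insert_self _ _))
      have h₁ : ∀ᶠ N : ℕ in atTop, ∀ i ∈ s, 0 < N * φ (v i) + η (v i) :=
        (Filter.eventually_all_finset s).2 fun i hi => eventually_pos_mul_add (hφ i hi) _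
      have h₂ : ∀ᶠ N : ℕ in atTop, ∀ j ∈ t, N * φ (w j) + η (w j) ≠ 0 :=
        (Filter.eventually_all_finset t).2 fun j hj => eventually_ne_mul_add (hφt j hj) _
      obtain ⟨N, hN₁, hN₂⟩ := (h₁.and h₂).exists
      refine ⟨N • φ + η, fun i hi => by simpa using hN₁ i hi, fun j hj => ?_⟩
      rcases Finset.mem_insert.1 hj with rfl | hj
      · simp [ha, hη]
      · simpa using hN₂ j hj
    · refine ⟨φ, hφ, fun j hj => ?_⟩
      rcases Finset.mem_insert.1 hj with rfl | hj
      · exact ha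
      · exact hφt j hj

/-- A finite subset of a positive monoid can be separated by a homomorphism to `ℚ` taking
nonnegative integral values on it, and the value `0` only at `1`. -/
theorem exists_monoidHom_natCast {M : Type u} [CancelCommMonoid M] [IsMulTorsionFree M]
    (hM : Subsingleton Mˣ) (S : Finset M) :
    ∃ φ : M →* Multiplicative ℚ, (∀ m ∈ S, ∃ k : ℕ, φ m = Multiplicative.ofAdd (k : ℚ)) ∧
      (∀ m ∈ S, φ m = 1 → m = 1) ∧ Set.InjOn φ S := by
  classical
  let G := Algebra.GrothendieckGroup M
  let j : M →* G := (Localization.monoidOf (⊤ : Submonoid M)).toMonoidHom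
  have hj : Function.Injective j := Localization.mk_left_injective 1
  have hunit : ∀ a b : M, a * b = 1 → a = 1 := fun a b hab => by
    have := hM.elim (⟨a, b, hab, by rw [mul_comm, hab]⟩ : Mˣ) 1
    exact congrArg Units.val this
  have hpow : ∀ (m : M) (n : ℕ), m ^ n = 1 → m ≠ 1 → n = 0 := fun m n hmn hm => by
    by_contra hn
    exact hm (pow_left_injective hn (by simpa using hmn))
  -- In a positive torsion-free monoid a product of powers of elements `≠ 1` is `1` only if all
  -- exponents vanish, and quotients of distinct elements have infinite order.
  obtain ⟨φ, hφ, hφ'⟩ := exists_addMonoidHom_pos_of_ne (G := Additive G) (S.erase 1)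
    (fun m => Additive.ofMul (j m)) (fun n hn m hm => by
      have h1 : ∏ m ∈ S.erase 1, m ^ n m = 1 := by
        apply hj
        rw [map_prod, map_one]
        have := congrArg Additive.toMul hn
        simpa using this
      rw [← Finset.mul_prod_erase _ _ hm] at h1
      exact hpow m (n m) (hunit _ _ h1) (Finset.ne_of_mem_erase hm))
    S.offDiag (fun p => Additive.ofMul (j p.1 / j p.2)) (fun p hp n hn => by
      have hne := (Finset.mem_offDiag.1 hp).2.2
      have : (j p.1 / j p.2) ^ n = 1 := congrArg Additive.toMul hn
      rw [div_pow, div_eq_one, ← map_pow, ← map_pow] at this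
      by_contra hn
      exact hne (pow_left_injective hn (hj this)))
  -- A common denominator makes the values on `S` integral.
  let d : ℕ := ∏ m ∈ S, (φ (Additive.ofMul (j m))).den
  have hd : d ≠ 0 := Finset.prod_ne_zero_iff.2 fun m _ => Rat.den_nz _
  let ψ : M →* Multiplicative ℚ :=
    AddMonoidHom.toMultiplicativeRight ((d • φ).comp (MonoidHom.toAdditive j))
  have hψ : ∀ m, ψ m = Multiplicative.ofAdd (d * φ (Additive.ofMul (j m))) := fun m => by
    simp [ψ]
  refine ⟨ψ, fun m hm => ?_, fun m hm h => ?_, fun m hm m' hm' h => ?_⟩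
  · set q := φ (Additive.ofMul (j m)) with hq
    have hq0 : 0 ≤ q := by
      by_cases h1 : m = 1
      · simp [hq, h1]
      · exact (hφ m (Finset.mem_erase.2 ⟨h1, hm⟩)).le
    obtain ⟨e, he⟩ : q.den ∣ d :=
      Finset.dvd_prod_of_mem (fun m => (φ (Additive.ofMul (j m))).den) hm
    refine ⟨q.num.toNat * e, ?_⟩
    rw [hψ, ← hq, he]
    congr 1
    push_cast
    have h1 : ((q.num.toNat : ℤ) : ℚ) = q.num := by
      rw [Int.toNat_of_nonneg (Rat.num_nonneg.2 hq0)]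
    have h2 : (q.num.toNat : ℚ) = q.num := by exact_mod_cast h1
    rw [h2, mul_right_comm, Rat.den_mul_eq_num]
  · by_contra h1
    have := hφ m (Finset.mem_erase.2 ⟨h1, hm⟩)
    rw [hψ, ofAdd_eq_one] at h
    rcases mul_eq_zero.1 h with h | h
    · exact hd (by exact_mod_cast h)
    · exact this.ne' h
  · by_contra hne
    have := hφ' (m, m') (Finset.mem_offDiag.2 ⟨hm, hm', hne⟩)
    rw [hψ, hψ] at h
    have h := mul_left_cancel₀ (by exact_mod_cast hd) (Multiplicative.ofAdd.injective h)
    apply this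
    rw [ofMul_div, map_sub, h, sub_self]

end Gordan

/-! ### Functoriality of `𝓘`. -/

section Functoriality

variable {A B A' B' A'' B'' : Type*} [CommRing A] [CommRing B] [Algebra A B] [CommRing A']
  [CommRing B'] [Algebra A' B'] [CommRing A''] [CommRing B''] [Algebra A'' B'']

theorem Inv.map_map {f : B →+* B'} {g : B' →+* B''} (hf : IsPairHom A A' f)
    (hg : IsPairHom A' A'' g) (hgf : IsPairHom A A'' (g.comp f)) (I : Inv A B) :
    Inv.map g hg (Inv.map f hf I) = Inv.map (g.comp f) hgf I := by
  refine Units.ext ?_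
  rw [Inv.map_apply_coe, Inv.map_apply_coe, Inv.map_apply_coe]
  apply le_antisymm
  · rw [Submodule.span_le]
    rintro _ ⟨z, hz, rfl⟩
    induction hz using Submodule.span_induction with
    | mem z hz =>
      obtain ⟨b, hb, rfl⟩ := hz
      exact Submodule.subset_span ⟨b, hb, rfl⟩
    | zero => rw [map_zero]; exact zero_mem _
    | add z w _ _ hz hw => rw [map_add]; exact add_mem hz hw
    | smul a z _ hz =>
      obtain ⟨a'', ha''⟩ := hg a
      rw [Algebra.smul_def, map_mul, ← ha'', ← Algebra.smul_def]
      exact Submodule.smul_mem _ _ hz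
  · apply Submodule.span_mono
    rintro _ ⟨b, hb, rfl⟩
    exact ⟨f b, Submodule.subset_span ⟨b, hb, rfl⟩, rfl⟩

theorem IsPairHom.comp {f : B →+* B'} {g : B' →+* B''} (hg : IsPairHom A' A'' g)
    (hf : IsPairHom A A' f) : IsPairHom A A'' (g.comp f) := fun a => by
  obtain ⟨a', ha'⟩ := hf a
  rw [RingHom.comp_apply, ← ha']
  exact hg a'

theorem Inv.map_comp_map_comm {D E : Type*} [CommRing D] [CommRing E] [Algebra D E] {f : B →+* B'}
    {g : B' →+* B''} {f' : B →+* E} {g' : E →+* B''} (hf : IsPairHom A A' f)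
    (hg : IsPairHom A' A'' g) (hf' : IsPairHom A D f') (hg' : IsPairHom D A'' g')
    (h : g.comp f = g'.comp f') :
    (Inv.map g hg).comp (Inv.map f hf) = (Inv.map g' hg').comp (Inv.map f' hf') := by
  refine MonoidHom.ext fun I => ?_
  rw [MonoidHom.comp_apply, MonoidHom.comp_apply, Inv.map_map hf hg (hg.comp hf),
    Inv.map_map hf' hg' (hg'.comp hf')]
  simp only [h]

theorem Inv.map_id (h : IsPairHom A A (RingHom.id B)) (I : Inv A B) :
    Inv.map (RingHom.id B) h I = I := by
  refine Units.ext ?_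
  rw [Inv.map_apply_coe, RingHom.coe_id, Set.image_id, Submodule.span_eq]

end Functoriality

/-! ### The isomorphism `θ` over a subintegrally closed ring. -/

section Theta

variable {R : Type*} {B : Type v} {M : Type w} [CommRing R] [CommRing B] [Algebra R B]
  [CancelCommMonoid M]

theorem isPairHom_singleOneRingHom :
    IsPairHom R (MonoidAlgebra R M) (MonoidAlgebra.singleOneRingHom : B →+* MonoidAlgebra B M) :=
  fun a => ⟨MonoidAlgebra.singleOneRingHom a, by simp⟩

theorem mul_eq_one_iff_of_subsingleton_units (hM : Subsingleton Mˣ) {a b : M} :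
    a * b = 1 ↔ a = 1 ∧ b = 1 := by
  refine ⟨fun hab => ?_, fun ⟨ha, hb⟩ => by rw [ha, hb, mul_one]⟩
  have : a = 1 := congrArg Units.val
    (hM.elim (⟨a, b, hab, by rw [mul_comm, hab]⟩ : Mˣ) 1)
  exact ⟨this, by rwa [this, one_mul] at hab⟩

open Classical in
/-- For a positive monoid `M`, the retraction `B[M] → B` sending every `m ≠ 1` to `0`. -/
noncomputable def constCoeff (hM : Subsingleton Mˣ) : MonoidAlgebra B M →+* B :=
  (MonoidAlgebra.lift B B M
    { toFun := fun m => if m = 1 then 1 else 0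
      map_one' := if_pos rfl
      map_mul' := fun a b => by
        simp only [mul_eq_one_iff_of_subsingleton_units hM]
        split_ifs <;> simp_all }).toRingHom

theorem constCoeff_apply (hM : Subsingleton Mˣ) (z : MonoidAlgebra B M) :
    constCoeff hM z = z.coeff 1 := by
  induction z using MonoidAlgebra.induction_linear with
  | zero => simp
  | add x y hx hy => simp [hx, hy]
  | single m b =>
    by_cases h : m = 1 <;>
      simp [constCoeff, MonoidAlgebra.lift_single, MonoidAlgebra.coeff_single, h]

theorem isPairHom_constCoeff (hM : Subsingleton Mˣ) :
    IsPairHom (MonoidAlgebra R M) R (constCoeff hM : MonoidAlgebra B M →+* B) := fun a =>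
  ⟨a.coeff 1, by rw [constCoeff_apply]; simp⟩

theorem constCoeff_comp (hM : Subsingleton Mˣ) :
    (constCoeff hM).comp (MonoidAlgebra.singleOneRingHom : B →+* MonoidAlgebra B M) =
      RingHom.id B := by
  ext b
  simp [constCoeff_apply]

theorem mem_one_monoidAlgebra {z : MonoidAlgebra B M} :
    z ∈ (1 : Submodule (MonoidAlgebra R M) (MonoidAlgebra B M)) ↔
      ∀ m, z.coeff m ∈ (algebraMap R B).range := by
  rw [Submodule.mem_one]
  have := MonoidAlgebra.range_map (M := M) (algebraMap R B : R →+ B)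
  have := Set.ext_iff.1 this z
  exact this

/-- The multivariate form of `IsNormalizedSystem.coeff_mem`. -/
theorem coeff_mem_of_sum_eq_one [IsMulTorsionFree M] (hM : Subsingleton Mˣ)
    (hcl : ∀ b : B, b ^ 2 ∈ (algebraMap R B).range → b ^ 3 ∈ (algebraMap R B).range →
      b ∈ (algebraMap R B).range) {ι : Type*} [Fintype ι] {x y : ι → MonoidAlgebra B M}
    (hxy : ∑ i, x i * y i = 1) (hmul : ∀ i j m, (x i * y j).coeff m ∈ (algebraMap R B).range)
    (hx : ∀ i, (x i).coeff 1 ∈ (algebraMap R B).range)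
    (hy : ∀ i, (y i).coeff 1 ∈ (algebraMap R B).range) (i : ι) (m : M) :
    (x i).coeff m ∈ (algebraMap R B).range := by
  classical
  obtain ⟨φ, hφ, hφ1, hinj⟩ := exists_monoidHom_natCast hM
    (insert 1 (Finset.univ.biUnion fun i => (x i).coeff.support ∪ (y i).coeff.support))
  set S := insert 1 (Finset.univ.biUnion fun i => (x i).coeff.support ∪ (y i).coeff.support) with hS
  -- The weight `φ` need not be a natural number on all of `M`, so the monomials are first
  -- restricted to the submonoid where it is.
  let N : Submonoid M :=
    { carrier := {m | ∃ k : ℕ, φ m = Multiplicative.ofAdd (k : ℚ)}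
      mul_mem' := by
        rintro a b ⟨k, hk⟩ ⟨l, hl⟩
        exact ⟨k + l, by rw [map_mul, hk, hl, ← ofAdd_add, Nat.cast_add]⟩
      one_mem' := ⟨0, by simp⟩ }
  choose κ hκ using fun m : N => m.2
  have hκ1 : κ 1 = 0 := by
    have := hκ 1
    rw [Submonoid.coe_one, map_one] at this
    exact_mod_cast (Multiplicative.ofAdd.injective this).symm
  have hκmul : ∀ a b, κ (a * b) = κ a + κ b := fun a b => by
    have := hκ (a * b)
    rw [Submonoid.coe_mul, map_mul, hκ a, hκ b, ← ofAdd_add] at this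
    exact_mod_cast (Multiplicative.ofAdd.injective this).symm
  -- Substituting `X ^ κ m` for `m` loses no coefficient of an element supported in `S`, where the
  -- weights are distinct. Products may leave `S`, but their images then have sums of elements of
  -- `R` as coefficients, which is enough. That `1 ∈ S` keeps the constant term separate.
  let P : MonoidAlgebra B N →ₐ[B] Polynomial B := MonoidAlgebra.lift B (Polynomial B) N
    { toFun := fun m => Polynomial.X ^ κ m
      map_one' := by rw [hκ1, pow_zero]
      map_mul' := fun a b => by rw [hκmul, pow_add] }
  have hP : ∀ z n, (P z).coeff n = z.coeff.sum fun m b => if κ m = n then b else 0 := fun z n => by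
    rw [MonoidAlgebra.lift_apply, Finsupp.sum, Polynomial.finsetSum_coeff]
    refine Finset.sum_congr rfl fun m _ => ?_
    simp [Polynomial.coeff_X_pow, eq_comm]
  have hPinj : ∀ (z : MonoidAlgebra B N), (∀ m ∈ z.coeff.support, (m : M) ∈ S) →
      ∀ m : N, (m : M) ∈ S → (P z).coeff (κ m) = z.coeff m := fun z hz m hm => by
    rw [hP, Finsupp.sum, Finset.sum_eq_single m]
    · simp
    · intro m' hm' hne
      rw [if_neg]
      intro h
      exact hne (Subtype.ext (hinj (hz m' hm') hm (by rw [hκ, hκ, h])))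
    · intro hm
      simpa using hm
  let ρ := MonoidAlgebra.mapDomainRingHom B N.subtype
  have hρ : Function.Injective ρ := MonoidAlgebra.mapDomain_injective Subtype.val_injective
  have hρc : ∀ (z : MonoidAlgebra B N) (m : N), (ρ z).coeff m = z.coeff m := fun z m =>
    Finsupp.mapDomain_apply Subtype.val_injective _ _
  have hlift : ∀ z : MonoidAlgebra B M, z.coeff.support ⊆ S → ∃ z', ρ z' = z := fun z hz =>
    ⟨_, MonoidAlgebra.mapDomain_comapDomain (fun m hm => ⟨⟨m, hφ m (hz hm)⟩, rfl⟩)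
      Subtype.val_injective⟩
  have hxS : ∀ i, (x i).coeff.support ⊆ S := fun i m hm => Finset.mem_insert_of_mem
    (Finset.mem_biUnion.2 ⟨i, Finset.mem_univ _, Finset.mem_union_left _ hm⟩)
  have hyS : ∀ i, (y i).coeff.support ⊆ S := fun i m hm => Finset.mem_insert_of_mem
    (Finset.mem_biUnion.2 ⟨i, Finset.mem_univ _, Finset.mem_union_right _ hm⟩)
  choose x' hx' using fun i => hlift (x i) (hxS i)
  choose y' hy' using fun i => hlift (y i) (hyS i)
  have hx'S : ∀ i, ∀ m ∈ (x' i).coeff.support, (m : M) ∈ S := fun i m hm => hxS i (by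
    rw [Finsupp.mem_support_iff] at hm ⊢
    rwa [← hx', hρc])
  have hy'S : ∀ i, ∀ m ∈ (y' i).coeff.support, (m : M) ∈ S := fun i m hm => hyS i (by
    rw [Finsupp.mem_support_iff] at hm ⊢
    rwa [← hy', hρc])
  have h1S : ((1 : N) : M) ∈ S := Finset.mem_insert_self _ _
  have hsys : IsNormalizedSystem R (fun i => P (x' i)) (fun i => P (y' i)) :=
    { sum_eq := by
        simp only [← map_mul]
        rw [← map_sum, ← map_one P]
        congr 1
        apply hρ
        rw [map_sum, map_one, ← hxy]
        exact Finset.sum_congr rfl fun i _ => by rw [map_mul, hx', hy']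
      coeff_mul := fun i j n => by
        rw [← map_mul, hP]
        refine sum_mem fun m _ => ?_
        dsimp only
        split_ifs
        · rw [← hρc, map_mul, hx', hy']
          exact hmul i j _
        · exact zero_mem _
      coeff_zero_left := fun i => by
        rw [← hκ1, hPinj _ (hx'S i) _ h1S, ← hρc, hx']
        exact hx i
      coeff_zero_right := fun i => by
        rw [← hκ1, hPinj _ (hy'S i) _ h1S, ← hρc, hy']
        exact hy i }
  by_cases hm : m ∈ (x i).coeff.support
  · have := hsys.coeff_mem hcl i (κ ⟨m, hφ m (hxS i hm)⟩)
    rw [hPinj _ (hx'S i) _ (hxS i hm), ← hρc, hx'] at this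
    exact this
  · rw [Finsupp.notMem_support_iff.1 hm]
    exact zero_mem _

/-- If `R` is subintegrally closed in `B` then `𝓘(R, B) → 𝓘(R[M], B[M])` is bijective. -/
theorem Inv.map_singleOneRingHom_bijective [IsMulTorsionFree M] (hM : Subsingleton Mˣ)
    (hcl : ∀ b : B, b ^ 2 ∈ (algebraMap R B).range → b ^ 3 ∈ (algebraMap R B).range →
      b ∈ (algebraMap R B).range) :
    Function.Bijective (Inv.map (MonoidAlgebra.singleOneRingHom : B →+* MonoidAlgebra B M)
      (isPairHom_singleOneRingHom (R := R))) := by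
  set Θ := Inv.map (MonoidAlgebra.singleOneRingHom : B →+* MonoidAlgebra B M)
      (isPairHom_singleOneRingHom (R := R)) with hΘ
  set ε := Inv.map (constCoeff hM : MonoidAlgebra B M →+* B)
    (isPairHom_constCoeff (R := R) hM) with hε
  have hεΘ : ∀ I, ε (Θ I) = I := fun I => by
    rw [hε, hΘ, Inv.map_map _ _ (by rw [constCoeff_comp]; exact fun a => ⟨a, rfl⟩)]
    simp only [constCoeff_comp]
    exact Inv.map_id _ _
  have hle : ∀ K : Inv (MonoidAlgebra R M) (MonoidAlgebra B M), ε K = 1 →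
      (K : Submodule (MonoidAlgebra R M) (MonoidAlgebra B M)) ≤ 1 := by
    intro K hK
    obtain ⟨n, x, y, hx, hy, hxy⟩ := Submodule.exists_fin_sum_of_mem_mul
      (show (1 : MonoidAlgebra B M) ∈
          (K : Submodule (MonoidAlgebra R M) (MonoidAlgebra B M)) * ↑K⁻¹ by
        rw [Units.mul_inv]; exact Submodule.one_le.1 le_rfl)
    have hconst : ∀ K : Inv (MonoidAlgebra R M) (MonoidAlgebra B M), ε K = 1 →
        ∀ z ∈ (K : Submodule (MonoidAlgebra R M) (MonoidAlgebra B M)),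
          z.coeff 1 ∈ (algebraMap R B).range := by
      intro K hK z hz
      have : constCoeff hM z ∈ (ε K : Submodule R B) := Submodule.subset_span ⟨z, hz, rfl⟩
      rw [hK, Units.val_one, Submodule.mem_one, constCoeff_apply] at this
      exact this
    have hcoeff := coeff_mem_of_sum_eq_one hM hcl hxy (fun i j m => by
        have := Submodule.mul_mem_mul (hx i) (hy j)
        rw [Units.mul_inv] at this
        exact mem_one_monoidAlgebra.1 this m)
      (fun i => hconst K hK _ (hx i)) (fun i => hconst K⁻¹ (by rw [map_inv, hK, inv_one]) _ (hy i))
    intro z hz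
    have : z = ∑ i, x i * (y i * z) := by
      simp only [← mul_assoc, ← Finset.sum_mul, hxy, one_mul]
    rw [this, ← mul_one (1 : Submodule (MonoidAlgebra R M) (MonoidAlgebra B M))]
    refine sum_mem fun i _ => Submodule.mul_mem_mul (mem_one_monoidAlgebra.2 (hcoeff i)) ?_
    rw [← Units.inv_mul K]
    exact Submodule.mul_mem_mul (hy i) hz
  refine ⟨Function.LeftInverse.injective hεΘ, fun J => ⟨ε J, ?_⟩⟩
  -- Since `ε` is a retraction, surjectivity of `Θ` amounts to triviality of the kernel of `ε`, and
  -- `hle` applies to an element of it and to its inverse.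
  have hK : ε (J * (Θ (ε J))⁻¹) = 1 := by rw [map_mul, map_inv, hεΘ, mul_inv_cancel]
  have := Inv.eq_one_of_le (hle _ hK) (hle _ (by rw [map_inv, hK, inv_one]))
  exact (mul_inv_eq_one.1 this).symm

end Theta

/-! ### The maps of the diagram. -/

section Diagram

variable (A : Type u) (B : Type v) [CommRing A] [CommRing B] [Algebra A B]
  (C : Subalgebra A B) (M : Type w) [CommMonoid M]

theorem inclMap_injective : Function.Injective (inclMap A B C) :=
  Inv.map_injective _ _ (fun r s => map_smul C.val r s) Subtype.val_injective

theorem inclMap_mulExact : Function.MulExact (inclMap A B C) (extMap A B C) :=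
  Inv.map_mulExact _ _ rfl _ Subtype.val_injective

theorem extMap_surjective (h : subintegralClosure A C = ⊤) : Function.Surjective (extMap A B C) :=
  Inv.map_surjective _ h

theorem isScalarTower_monoidAlgebra_subalgebra :
    IsScalarTower (MonoidAlgebra A M) (MonoidAlgebra C M) (MonoidAlgebra B M) :=
  .of_algebraMap_eq fun x => by
    change MonoidAlgebra.map (algebraMap A B : A →+ B) x =
      MonoidAlgebra.map (algebraMap C B : C →+ B) (MonoidAlgebra.map (algebraMap A C : A →+ C) x)
    rw [MonoidAlgebra.map_map]
    rfl

theorem inclMapMonoid_injective : Function.Injective (inclMapMonoid A B C M) := by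
  have := isScalarTower_monoidAlgebra_subalgebra A B C M
  refine Inv.map_injective _ _ (fun r s => ?_) (MonoidAlgebra.map_injective _ Subtype.val_injective)
  exact map_smul
    (IsScalarTower.toAlgHom (MonoidAlgebra A M) (MonoidAlgebra C M) (MonoidAlgebra B M)) r s

theorem inclMapMonoid_mulExact :
    Function.MulExact (inclMapMonoid A B C M) (extMapMonoid A B C M) := by
  have := isScalarTower_monoidAlgebra_subalgebra A B C M
  exact Inv.map_mulExact _ _ rfl _ (MonoidAlgebra.map_injective _ Subtype.val_injective)

theorem extMapMonoid_surjective (h : subintegralClosure A C = ⊤) :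
    Function.Surjective (extMapMonoid A B C M) := by
  have := isScalarTower_monoidAlgebra_subalgebra A B C M
  exact Inv.map_surjective _ (subintegralClosure_monoidAlgebra_eq_top h M)

theorem theta_comp_inclMap :
    (theta A B M).comp (inclMap A B C) = (inclMapMonoid A B C M).comp (theta A C M) := by
  refine Inv.map_comp_map_comm _ _ _ _ (RingHom.ext fun c => ?_)
  exact (MonoidAlgebra.map_single ((C.val : C →+* B) : C →+ B) c (1 : M)).symm

theorem theta_comp_extMap :
    (theta C B M).comp (extMap A B C) = (extMapMonoid A B C M).comp (theta A B M) :=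
  Inv.map_comp_map_comm _ _ _ _ rfl

end Diagram

/-! ### Polynomial models of `D exp(∫ω)` and their invertibility. -/

section Exponential

open Polynomial

variable {A C : Type*} [CommRing A] [CommRing C] [Algebra A C]

/-- `D[X]` as a subalgebra of `C[X]`. -/
def polySubalgebra (D : Subalgebra A C) : Subalgebra A C[X] where
  carrier := {f | ∀ n, f.coeff n ∈ D}
  mul_mem' hf hg n := by
    rw [coeff_mul]
    exact sum_mem fun p _ => mul_mem (hf _) (hg _)
  add_mem' hf hg n := by rw [coeff_add]; exact add_mem (hf n) (hg n)
  algebraMap_mem' a n := by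
    rw [Polynomial.algebraMap_apply, coeff_C]
    split_ifs
    · exact D.algebraMap_mem a
    · exact D.zero_mem

theorem C_mem_polySubalgebra {D : Subalgebra A C} {c : C} (hc : c ∈ D) :
    Polynomial.C c ∈ polySubalgebra D := fun n => by
  rw [coeff_C]
  split_ifs
  · exact hc
  · exact D.zero_mem

theorem X_mem_polySubalgebra (D : Subalgebra A C) : (X : C[X]) ∈ polySubalgebra D := fun n => by
  rw [coeff_X]
  split_ifs
  · exact D.one_mem
  · exact D.zero_mem

theorem polySubalgebra_mono {D E : Subalgebra A C} (h : D ≤ E) :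
    polySubalgebra D ≤ polySubalgebra E := fun _ hf n => h (hf n)

theorem derivative_mem_polySubalgebra {D : Subalgebra A C} {f : C[X]} (hf : f ∈ polySubalgebra D) :
    derivative f ∈ polySubalgebra D := fun n => by
  rw [coeff_derivative]
  exact mul_mem (hf _) (add_mem (natCast_mem D n) D.one_mem)

theorem polySubalgebra_sup_adjoin {D : Subalgebra A C} {b : C} (h2 : b ^ 2 ∈ D) :
    polySubalgebra (D ⊔ Algebra.adjoin A {b}) =
      polySubalgebra D ⊔ Algebra.adjoin A {Polynomial.C b} := by
  refine le_antisymm (fun f hf => ?_) (sup_le (polySubalgebra_mono le_sup_left) ?_)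
  · rw [f.as_sum_range_C_mul_X_pow]
    refine sum_mem fun n _ => ?_
    obtain ⟨p, hp, q, hq, hpq⟩ := (mem_sup_adjoin_iff h2).1 (hf n)
    rw [hpq, C_add, C_mul]
    have hX : (X : C[X]) ^ n ∈ polySubalgebra D ⊔ Algebra.adjoin A {Polynomial.C b} :=
      pow_mem (Algebra.mem_sup_left (X_mem_polySubalgebra D)) n
    exact mul_mem (add_mem (Algebra.mem_sup_left (C_mem_polySubalgebra hp))
      (mul_mem (Algebra.mem_sup_right (Algebra.self_mem_adjoin_singleton A _))
        (Algebra.mem_sup_left (C_mem_polySubalgebra hq)))) hX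
  · rw [Algebra.adjoin_le_iff, Set.singleton_subset_iff]
    exact C_mem_polySubalgebra (Algebra.mem_sup_right (Algebra.self_mem_adjoin_singleton A _))

theorem IsElementarySubintegral.polySubalgebra {D E : Subalgebra A C}
    (h : IsElementarySubintegral D E) :
    IsElementarySubintegral (polySubalgebra D) (polySubalgebra E) := by
  obtain ⟨b, h2, h3, rfl⟩ := h
  refine ⟨Polynomial.C b, ?_, ?_, polySubalgebra_sup_adjoin h2⟩
  · rw [← C_pow]; exact C_mem_polySubalgebra h2
  · rw [← C_pow]; exact C_mem_polySubalgebra h3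

theorem reflTransGen_polySubalgebra {D E : Subalgebra A C}
    (h : Relation.ReflTransGen IsElementarySubintegral D E) :
    Relation.ReflTransGen IsElementarySubintegral (polySubalgebra D) (polySubalgebra E) := by
  induction h with
  | refl => exact .refl
  | tail _ h ih => exact ih.tail h.polySubalgebra

variable (A) in
/-- The operator `f ↦ f' - ω f` on `C[X]`. -/
noncomputable def twistedDeriv (ω : C[X]) : C[X] →ₗ[A] C[X] :=
  derivative.restrictScalars A - LinearMap.mulLeft A ω

theorem twistedDeriv_apply (ω f : C[X]) : twistedDeriv A ω f = derivative f - ω * f := rfl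

theorem twistedDeriv_mul (ω ω' f g : C[X]) : twistedDeriv A (ω + ω') (f * g) =
    twistedDeriv A ω f * g + f * twistedDeriv A ω' g := by
  simp only [twistedDeriv_apply, derivative_mul]
  ring

/-- The polynomials `f` over `C` such that all iterates of `f` under `f ↦ f' - ω f` have constant
term in `D`. Over a `ℚ`-algebra these are the `f` for which `exp (-∫ω) f` has coefficients in
`D`. -/
def expSubmodule (D : Subalgebra A C) (ω : C[X]) : Submodule A C[X] where
  carrier := {f | ∀ n : ℕ, ((twistedDeriv A ω ^ n) f).coeff 0 ∈ D}
  add_mem' hf hg n := by rw [map_add, coeff_add]; exact add_mem (hf n) (hg n)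
  zero_mem' n := by rw [map_zero, coeff_zero]; exact D.zero_mem
  smul_mem' a f hf n := by rw [map_smul, coeff_smul]; exact D.smul_mem (hf n) a

theorem mem_expSubmodule_iff {D : Subalgebra A C} {ω f : C[X]} : f ∈ expSubmodule D ω ↔
    f.coeff 0 ∈ D ∧ twistedDeriv A ω f ∈ expSubmodule D ω := by
  refine ⟨fun h => ⟨h 0, fun n => ?_⟩, fun h n => ?_⟩
  · rw [← Module.End.mul_apply, ← pow_succ]; exact h (n + 1)
  · cases n with
    | zero => exact h.1
    | succ n => rw [pow_succ, Module.End.mul_apply]; exact h.2 n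

theorem le_expSubmodule {D : Subalgebra A C} {ω : C[X]} {N : Submodule A C[X]}
    (h0 : ∀ f ∈ N, f.coeff 0 ∈ D) (hN : ∀ f ∈ N, twistedDeriv A ω f ∈ N) :
    N ≤ expSubmodule D ω := by
  have : ∀ n : ℕ, ∀ f ∈ N, (twistedDeriv A ω ^ n) f ∈ N := fun n => by
    induction n with
    | zero => exact fun f hf => hf
    | succ n ih => exact fun f hf => by rw [pow_succ, Module.End.mul_apply]; exact ih _ (hN f hf)
  exact fun f hf n => h0 _ (this n f hf)

theorem expSubmodule_mono {D E : Subalgebra A C} (h : D ≤ E) (ω : C[X]) :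
    expSubmodule D ω ≤ expSubmodule E ω := fun _ hf n => h (hf n)

/-- The functional equation of the exponential, in the form of the Leibniz rule `twistedDeriv_mul`.
-/
theorem expSubmodule_mul_le (D : Subalgebra A C) (ω ω' : C[X]) :
    expSubmodule D ω * expSubmodule D ω' ≤ expSubmodule D (ω + ω') := by
  refine le_expSubmodule (fun f hf => ?_) (fun f hf => ?_)
  · induction hf using Submodule.mul_induction_on' with
    | mem_mul_mem f hf g hg => rw [mul_coeff_zero]; exact mul_mem (hf 0) (hg 0)
    | add f _ g _ hf hg => rw [coeff_add]; exact add_mem hf hg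
  · induction hf using Submodule.mul_induction_on' with
    | mem_mul_mem f hf g hg =>
      rw [twistedDeriv_mul]
      exact add_mem (Submodule.mul_mem_mul (mem_expSubmodule_iff.1 hf).2 hg)
        (Submodule.mul_mem_mul hf (mem_expSubmodule_iff.1 hg).2)
    | add f _ g _ hf hg => rw [map_add]; exact add_mem hf hg

theorem polySubalgebra_le_expSubmodule {D : Subalgebra A C} {ω : C[X]}
    (hω : ω ∈ polySubalgebra D) : (polySubalgebra D).toSubmodule ≤ expSubmodule D ω :=
  le_expSubmodule (fun _ hf => hf 0)
    fun _ hf => (polySubalgebra D).sub_mem (derivative_mem_polySubalgebra hf)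
      ((polySubalgebra D).mul_mem hω hf)

theorem one_mem_expSubmodule {D : Subalgebra A C} {ω : C[X]} (hω : ω ∈ polySubalgebra D) :
    (1 : C[X]) ∈ expSubmodule D ω :=
  polySubalgebra_le_expSubmodule hω (polySubalgebra D).one_mem

theorem mem_of_natCast_mul_mem (hA : ∀ n : ℕ, n ≠ 0 → IsUnit (n : A)) {D : Subalgebra A C} {n : ℕ}
    (hn : n ≠ 0) {c : C} (h : n * c ∈ D) : c ∈ D := by
  obtain ⟨u, hu⟩ := hA n hn
  have : c = (↑u⁻¹ : A) • ((n : C) * c) := by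
    rw [← map_natCast (algebraMap A C) n, ← hu, Algebra.smul_def, ← mul_assoc, ← map_mul,
      Units.inv_mul, map_one, one_mul]
  rw [this]
  exact D.smul_mem h _

/-- The constant term of the `n`-th derivative is `n!` times the `n`-th coefficient, and `n!` is
invertible. -/
theorem expSubmodule_zero (hA : ∀ n : ℕ, n ≠ 0 → IsUnit (n : A)) (D : Subalgebra A C) :
    expSubmodule D 0 = (polySubalgebra D).toSubmodule := by
  refine le_antisymm (fun f hf n => ?_) (polySubalgebra_le_expSubmodule (zero_mem _))
  have h : ∀ n : ℕ, (twistedDeriv A (0 : C[X]) ^ n) f = derivative^[n] f := fun n => by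
    induction n with
    | zero => rfl
    | succ n ih =>
      rw [pow_succ', Module.End.mul_apply, ih, Function.iterate_succ_apply', twistedDeriv_apply,
        zero_mul, sub_zero]
  have := hf n
  rw [h, coeff_iterate_derivative, zero_add, Nat.descFactorial_self, nsmul_eq_mul] at this
  exact mem_of_natCast_mul_mem hA (Nat.factorial_ne_zero n) this

theorem expSubmodule_mul_neg_le (hA : ∀ n : ℕ, n ≠ 0 → IsUnit (n : A)) (D : Subalgebra A C)
    (ω : C[X]) : expSubmodule D ω * expSubmodule D (-ω) ≤ (polySubalgebra D).toSubmodule := by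
  rw [← expSubmodule_zero hA, ← add_neg_cancel ω]
  exact expSubmodule_mul_le D ω (-ω)

theorem polySubalgebra_mul_expSubmodule_le (hA : ∀ n : ℕ, n ≠ 0 → IsUnit (n : A))
    (D : Subalgebra A C) (ω : C[X]) :
    (polySubalgebra D).toSubmodule * expSubmodule D ω ≤ expSubmodule D ω := by
  rw [← expSubmodule_zero hA]
  simpa using expSubmodule_mul_le D 0 ω

theorem exists_primitive (hA : ∀ n : ℕ, n ≠ 0 → IsUnit (n : A)) {D : Subalgebra A C} {f : C[X]}
    (hf : f ∈ polySubalgebra D) : ∃ g ∈ polySubalgebra D, derivative g = f ∧ g.coeff 0 = 0 := by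
  rw [f.as_sum_range_C_mul_X_pow]
  refine Finset.sum_induction _ (fun f => ∃ g ∈ polySubalgebra D, derivative g = f ∧ g.coeff 0 = 0)
    ?_ ⟨0, zero_mem _, by simp, by simp⟩ ?_
  · rintro _ _ ⟨g₁, hg₁, rfl, h₁⟩ ⟨g₂, hg₂, rfl, h₂⟩
    exact ⟨g₁ + g₂, add_mem hg₁ hg₂, by simp, by simp [h₁, h₂]⟩
  · intro n _
    obtain ⟨u, hu⟩ := hA (n + 1) n.succ_ne_zero
    refine ⟨(↑u⁻¹ : A) • (Polynomial.C (f.coeff n) * X ^ (n + 1)), (polySubalgebra D).smul_mem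
      (mul_mem (C_mem_polySubalgebra (hf n)) (pow_mem (X_mem_polySubalgebra D) _)) _, ?_, ?_⟩
    · rw [← LinearMap.restrictScalars_apply (R := A) (S := C) derivative, map_smul,
        LinearMap.restrictScalars_apply, derivative_C_mul_X_pow, Nat.add_sub_cancel]
      have : (((n + 1 : ℕ) : C)) = algebraMap A C u := by rw [hu, map_natCast]
      rw [this, C_mul, mul_comm (Polynomial.C _) (Polynomial.C _), mul_assoc,
        ← Polynomial.algebraMap_apply, ← Algebra.smul_def, smul_smul, Units.inv_mul, one_smul]
    · simp

/-- With `E = D[b]`, the module `b ^ 2 E[X]` is stable under `f ↦ f' - ω f`, and its constant terms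
lie in `b ^ 2 E ⊂ D`. -/
theorem C_sq_mul_mem_expSubmodule {D : Subalgebra A C} {b : C} (h2 : b ^ 2 ∈ D) (h3 : b ^ 3 ∈ D)
    {f ω : C[X]} (hf : f ∈ polySubalgebra (D ⊔ Algebra.adjoin A {b}))
    (hω : ω ∈ polySubalgebra (D ⊔ Algebra.adjoin A {b})) :
    Polynomial.C b ^ 2 * f ∈ expSubmodule D ω := by
  set E := D ⊔ Algebra.adjoin A {b}
  refine le_expSubmodule (N := (polySubalgebra E).toSubmodule.map
    (LinearMap.mulLeft A (Polynomial.C b ^ 2))) ?_ ?_ ⟨f, hf, rfl⟩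
  · rintro _ ⟨f, hf, rfl⟩
    rw [LinearMap.mulLeft_apply, mul_coeff_zero, ← C_pow, coeff_C_zero]
    exact mul_mem_of_sq_of_cube h2 h3 ((mem_sup_adjoin_iff h2).1 (hf 0))
  · rintro _ ⟨f, hf, rfl⟩
    refine ⟨derivative f - ω * f, (polySubalgebra E).sub_mem (derivative_mem_polySubalgebra hf)
      ((polySubalgebra E).mul_mem hω hf), ?_⟩
    simp only [LinearMap.mulLeft_apply, twistedDeriv_apply, ← C_pow, derivative_C_mul]
    ring

theorem C_mul_mem_polySubalgebra {D : Subalgebra A C} (b : C) {f : C[X]}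
    (hf : f ∈ polySubalgebra D) :
    Polynomial.C b * f ∈ polySubalgebra (D ⊔ Algebra.adjoin A {b}) :=
  mul_mem (C_mem_polySubalgebra (Algebra.mem_sup_right (Algebra.self_mem_adjoin_singleton A _)))
    (polySubalgebra_mono le_sup_left hf)

/-- The truncation `1 + b g` of `exp(b g)` works because its twisted derivative is `-b ^ 2 f g`,
covered by `C_sq_mul_mem_expSubmodule`. -/
theorem one_add_C_mul_mem_expSubmodule {D : Subalgebra A C} {b : C} (h2 : b ^ 2 ∈ D)
    (h3 : b ^ 3 ∈ D) {f g : C[X]} (hf : f ∈ polySubalgebra D) (hg : g ∈ polySubalgebra D)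
    (hgf : derivative g = f) (hg0 : g.coeff 0 = 0) :
    1 + Polynomial.C b * g ∈ expSubmodule D (Polynomial.C b * f) := by
  rw [mem_expSubmodule_iff]
  refine ⟨by simp [hg0, mul_coeff_zero], ?_⟩
  have : twistedDeriv A (Polynomial.C b * f) (1 + Polynomial.C b * g) =
      Polynomial.C b ^ 2 * (-(f * g)) := by
    rw [twistedDeriv_apply, derivative_add, derivative_one, derivative_C_mul, hgf]
    ring
  rw [this]
  exact C_sq_mul_mem_expSubmodule h2 h3
    (polySubalgebra_mono le_sup_left (neg_mem (mul_mem hf hg))) (C_mul_mem_polySubalgebra b hf)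

/-- The classes `exp (∫ω)` for `ω ∈ b D[X]`, where `D[b]` is elementary subintegral over `D`. -/
theorem one_mem_expSubmodule_mul_of_elementary (hA : ∀ n : ℕ, n ≠ 0 → IsUnit (n : A))
    {D : Subalgebra A C} {b : C} (h2 : b ^ 2 ∈ D) (h3 : b ^ 3 ∈ D) {f : C[X]}
    (hf : f ∈ polySubalgebra D) :
    (1 : C[X]) ∈ expSubmodule D (Polynomial.C b * f) * expSubmodule D (-(Polynomial.C b * f)) := by
  obtain ⟨g, hg, hgf, hg0⟩ := exists_primitive hA hf
  have hbf := C_mul_mem_polySubalgebra b hf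
  have h₁ := one_add_C_mul_mem_expSubmodule h2 h3 hf hg hgf hg0
  have h₂ := one_add_C_mul_mem_expSubmodule h2 h3 (neg_mem hf) (neg_mem hg)
    (by rw [derivative_neg, hgf]) (by rw [coeff_neg, hg0, neg_zero])
  rw [mul_neg, mul_neg] at h₂
  have hg2 : g ^ 2 ∈ polySubalgebra (D ⊔ Algebra.adjoin A {b}) :=
    polySubalgebra_mono le_sup_left (pow_mem hg 2)
  have h₃ := Submodule.mul_mem_mul (C_sq_mul_mem_expSubmodule h2 h3 hg2 hbf)
    (C_sq_mul_mem_expSubmodule h2 h3 hg2 (neg_mem hbf))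
  have h₄ := Submodule.mul_mem_mul h₁ h₂
  have h₅ : 1 + Polynomial.C b ^ 2 * g ^ 2 ∈ polySubalgebra D := by
    rw [← C_pow]
    exact add_mem (one_mem _) (mul_mem (C_mem_polySubalgebra h2) (pow_mem hg 2))
  have h₆ := Submodule.mul_mem_mul (show _ ∈ (polySubalgebra D).toSubmodule from h₅) h₄
  rw [← mul_assoc] at h₆
  have h₇ := mul_mono_left (polySubalgebra_mul_expSubmodule_le hA D _) h₆
  -- The product of the truncations of `exp(b g)` and `exp(-b g)` is `1 - b ^ 2 g ^ 2`, inverted by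
  -- `1 + b ^ 2 g ^ 2` up to `b ^ 4 g ^ 4`.
  have : (1 : C[X]) = (1 + Polynomial.C b ^ 2 * g ^ 2) * ((1 + Polynomial.C b * g) *
      (1 + -(Polynomial.C b * g))) + Polynomial.C b ^ 2 * g ^ 2 * (Polynomial.C b ^ 2 * g ^ 2) := by
    ring
  rw [this]
  exact add_mem h₇ h₃

theorem one_mem_expSubmodule_mul_add {D : Subalgebra A C} {ω ω' : C[X]}
    (h : (1 : C[X]) ∈ expSubmodule D ω * expSubmodule D (-ω))
    (h' : (1 : C[X]) ∈ expSubmodule D ω' * expSubmodule D (-ω')) :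
    (1 : C[X]) ∈ expSubmodule D (ω + ω') * expSubmodule D (-(ω + ω')) := by
  have := Submodule.mul_mem_mul h h'
  rw [mul_one, mul_mul_mul_comm] at this
  rw [neg_add]
  exact mul_le_mul' (expSubmodule_mul_le D ω ω') (expSubmodule_mul_le D (-ω) (-ω')) this

/-- Over `A`, a class `exp (∫ω)` defined over `D` can be corrected by some `ω₁ ∈ D[X]`. -/
theorem exists_add_of_one_mem (hA : ∀ n : ℕ, n ≠ 0 → IsUnit (n : A)) {D : Subalgebra A C}
    (hD : IsFiniteSubintegral D) {ω : C[X]}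
    (h : (1 : C[X]) ∈ expSubmodule D ω * expSubmodule D (-ω)) :
    ∃ ω₁ ∈ polySubalgebra D, (1 : C[X]) ∈
      expSubmodule (⊥ : Subalgebra A C) (ω + ω₁) * expSubmodule ⊥ (-(ω + ω₁)) := by
  have hprod := mul_eq_of_one_mem (polySubalgebra_mul_expSubmodule_le hA D ω)
    (expSubmodule_mul_neg_le hA D ω) h
  obtain ⟨J, hJ, K, hK, hJK, hJs, hKs⟩ := exists_descent (reflTransGen_polySubalgebra hD) hprod
    (polySubalgebra_mul_expSubmodule_le hA D ω) (polySubalgebra_mul_expSubmodule_le hA D (-ω))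
  have hJKm : ∀ {x y}, x ∈ J → y ∈ K → x * y ∈ polySubalgebra (⊥ : Subalgebra A C) :=
    fun hx hy => by
      have := Submodule.mul_mem_mul hx hy
      rwa [hJK] at this
  have hJm : ∀ {x c}, x ∈ J → c ∈ polySubalgebra (⊥ : Subalgebra A C) → x * c ∈ J :=
    fun hx hc => by rw [mul_comm]; exact hJs (Submodule.mul_mem_mul hc hx)
  have hKm : ∀ {x c}, x ∈ K → c ∈ polySubalgebra (⊥ : Subalgebra A C) → c * x ∈ K :=
    fun hx hc => hKs (Submodule.mul_mem_mul hc hx)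
  obtain ⟨n, x, y, hx, hy, hxy⟩ := Submodule.exists_fin_sum_of_mem_mul
    (show (1 : C[X]) ∈ J * K by rw [hJK]; exact (polySubalgebra (⊥ : Subalgebra A C)).one_mem)
  have hω₁ : ∑ i, twistedDeriv A ω (x i) * y i ∈ polySubalgebra D := by
    refine sum_mem fun i _ => ?_
    exact expSubmodule_mul_neg_le hA D ω (Submodule.mul_mem_mul
      (mem_expSubmodule_iff.1 (hJ (hx i))).2 (hK (hy i)))
  -- The descended module `J` need not be stable under the twisted derivative. It does carry the
  -- connection `z ↦ ∑ x i * (y i * z)'`, which differs from the twisted derivative by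
  -- multiplication by `ω₁`; so `ω + ω₁` preserves `J`, and dually `K`.
  set ω₁ := ∑ i, twistedDeriv A ω (x i) * y i with hω₁_def
  have hω₁' : ω₁ = -∑ i, x i * twistedDeriv A (-ω) (y i) := by
    have h0 : ∑ i, twistedDeriv A (ω + -ω) (x i * y i) = 0 := by
      rw [← map_sum, hxy, twistedDeriv_apply]
      simp
    simp only [twistedDeriv_mul, Finset.sum_add_distrib] at h0
    exact eq_neg_of_add_eq_zero_left h0
  have hJd : ∀ z ∈ J, twistedDeriv A (ω + ω₁) z ∈ J := by
    intro z hz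
    have e : z = ∑ i, x i * (y i * z) := by
      simp only [← mul_assoc, ← Finset.sum_mul, hxy, one_mul]
    have e' : twistedDeriv A (ω + ω₁) z = ∑ i, x i * derivative (y i * z) := by
      have : twistedDeriv A ω z = ∑ i, x i * derivative (y i * z) + ω₁ * z := by
        conv_lhs => rw [e, map_sum]
        rw [hω₁_def, Finset.sum_mul, ← Finset.sum_add_distrib]
        refine Finset.sum_congr rfl fun i _ => ?_
        simp only [twistedDeriv_apply, derivative_mul]
        ring
      rw [twistedDeriv_apply] at this ⊢
      linear_combination this
    rw [e']
    exact sum_mem fun i _ => hJm (hx i) (derivative_mem_polySubalgebra (by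
      rw [mul_comm]; exact hJKm hz (hy i)))
  have hKd : ∀ z ∈ K, twistedDeriv A (-(ω + ω₁)) z ∈ K := by
    intro z hz
    have e : z = ∑ i, (z * x i) * y i := by
      simp only [mul_assoc, ← Finset.mul_sum, hxy, mul_one]
    have e' : twistedDeriv A (-(ω + ω₁)) z = ∑ i, derivative (z * x i) * y i := by
      have : twistedDeriv A (-ω) z = ∑ i, derivative (z * x i) * y i +
          z * ∑ i, x i * twistedDeriv A (-ω) (y i) := by
        conv_lhs => rw [e, map_sum]
        rw [Finset.mul_sum, ← Finset.sum_add_distrib]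
        refine Finset.sum_congr rfl fun i _ => ?_
        simp only [twistedDeriv_apply, derivative_mul]
        ring
      rw [twistedDeriv_apply] at this ⊢
      rw [hω₁']
      linear_combination this
    rw [e']
    exact sum_mem fun i _ => hKm (hy i) (derivative_mem_polySubalgebra (by
      rw [mul_comm]; exact hJKm (hx i) hz))
  -- Constant terms of `J` need not lie in `A`. Multiplying `J` by the constant terms of `K`, and
  -- `K` by those of `J`, repairs this, since products of such constants are constant terms of `J *
  -- K = A[X]`; stability is kept because constants have derivative `0`.
  let c : C[X] →ₗ[A] C[X] := (CAlgHom : C →ₐ[A] C[X]).toLinearMap ∘ₗ (lcoeff C 0).restrictScalars A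
  have hc : ∀ f : C[X], c f = Polynomial.C (f.coeff 0) := fun f => rfl
  have hstab : ∀ (ω : C[X]) (N N' : Submodule A C[X]), (∀ z ∈ N, twistedDeriv A ω z ∈ N) →
      ∀ z ∈ N * N'.map c, twistedDeriv A ω z ∈ N * N'.map c := by
    intro ω N N' hN z hz
    induction hz using Submodule.mul_induction_on' with
    | mem_mul_mem f hf g hg =>
      obtain ⟨g', hg', rfl⟩ := hg
      have : twistedDeriv A ω (f * c g') = twistedDeriv A ω f * c g' := by
        simp only [twistedDeriv_apply, hc, derivative_mul, derivative_C]
        ring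
      rw [this]
      exact Submodule.mul_mem_mul (hN f hf) ⟨g', hg', rfl⟩
    | add f _ g _ hf hg => rw [map_add]; exact add_mem hf hg
  have hconst : ∀ N N' : Submodule A C[X], N * N' ≤ (polySubalgebra ⊥).toSubmodule →
      ∀ z ∈ N * N'.map c, z.coeff 0 ∈ (⊥ : Subalgebra A C) := by
    intro N N' hN z hz
    induction hz using Submodule.mul_induction_on' with
    | mem_mul_mem f hf g hg =>
      obtain ⟨g', hg', rfl⟩ := hg
      rw [hc, mul_coeff_zero, coeff_C_zero, ← mul_coeff_zero]
      exact hN (Submodule.mul_mem_mul hf hg') 0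
    | add f _ g _ hf hg => rw [coeff_add]; exact add_mem hf hg
  refine ⟨ω₁, hω₁, ?_⟩
  have hJ₁ := le_expSubmodule (hconst J K hJK.le) (hstab _ J K hJd)
  have hK₁ := le_expSubmodule (hconst K J (by rw [mul_comm]; exact hJK.le)) (hstab _ K J hKd)
  refine mul_le_mul' hJ₁ hK₁ ?_
  rw [mul_mul_mul_comm, mul_comm (K.map c), hJK]
  have h1 : (1 : C[X]) ∈ J.map c * K.map c := by
    have : (1 : C[X]) = ∑ i, c (x i) * c (y i) := by
      simp only [hc, ← C_mul, ← mul_coeff_zero]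
      rw [← map_sum, ← finsetSum_coeff, hxy, coeff_one_zero, C_1]
    rw [this]
    exact sum_mem fun i _ => Submodule.mul_mem_mul ⟨_, hx i, rfl⟩ ⟨_, hy i, rfl⟩
  simpa using Submodule.mul_mem_mul
    (show (1 : C[X]) ∈ (polySubalgebra (⊥ : Subalgebra A C)).toSubmodule
      from (polySubalgebra ⊥).one_mem) h1

theorem one_mem_expSubmodule_mul_of_isFiniteSubintegral (hA : ∀ n : ℕ, n ≠ 0 → IsUnit (n : A))
    {D : Subalgebra A C} (hD : IsFiniteSubintegral D) {ω : C[X]} (hω : ω ∈ polySubalgebra D) :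
    (1 : C[X]) ∈ expSubmodule (⊥ : Subalgebra A C) ω * expSubmodule ⊥ (-ω) := by
  unfold IsFiniteSubintegral at hD
  induction hD generalizing ω with
  | refl =>
    rw [← one_mul 1]
    exact Submodule.mul_mem_mul (one_mem_expSubmodule hω) (one_mem_expSubmodule (neg_mem hω))
  | @tail D E hD hE ih =>
    obtain ⟨b, h2, h3, rfl⟩ := hE
    rw [polySubalgebra_sup_adjoin h2] at hω
    obtain ⟨ω₀, hω₀, f, hf, rfl⟩ := (mem_sup_adjoin_iff (by
      rw [← C_pow]; exact C_mem_polySubalgebra h2)).1 hω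
    have hb := one_mem_expSubmodule_mul_of_elementary hA h2 h3 hf
    -- The class of `b f` is invertible over `D`, but over `A` only after adding `ω₁ ∈ D[X]`, which
    -- the induction hypothesis removes again. As `ω₁` is a polynomial, the induction has to run
    -- over polynomials `ω`, not only constants.
    obtain ⟨ω₁, hω₁, h⟩ := exists_add_of_one_mem hA hD hb
    have h' := one_mem_expSubmodule_mul_add h (ih ((polySubalgebra D).neg_mem hω₁))
    rw [add_neg_cancel_right] at h'
    exact one_mem_expSubmodule_mul_add (ih hω₀) h'

end Exponential

/-! ### The exponential isomorphism `C/A ≅ 𝓘(A, C)`. -/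

section Exponential

open Polynomial

variable {A C : Type*} [CommRing A] [CommRing C] [Algebra A C]

variable (A C) in
/-- Evaluation at `1`. -/
noncomputable def evalOne : C[X] →ₐ[A] C := (aeval (R := C) (1 : C)).restrictScalars A

theorem evalOne_C (c : C) : evalOne A C (Polynomial.C c) = c := by
  simp [evalOne]

/-- The `D`-submodule `D exp(b)` of `C`. -/
noncomputable def expClass (D : Subalgebra A C) (b : C) : Submodule A C :=
  (expSubmodule D (Polynomial.C b)).map (evalOne A C).toLinearMap

theorem expClass_mul_le (D : Subalgebra A C) (b c : C) :
    expClass D b * expClass D c ≤ expClass D (b + c) := by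
  rw [expClass, expClass, ← Submodule.map_mul, expClass, C_add]
  exact Submodule.map_mono (expSubmodule_mul_le D _ _)

theorem expClass_mono {D E : Subalgebra A C} (h : D ≤ E) (b : C) : expClass D b ≤ expClass E b :=
  Submodule.map_mono (expSubmodule_mono h _)

theorem expClass_zero (hA : ∀ n : ℕ, n ≠ 0 → IsUnit (n : A)) (D : Subalgebra A C) :
    expClass D 0 = D.toSubmodule := by
  rw [expClass, C_0, expSubmodule_zero hA]
  apply le_antisymm
  · rintro _ ⟨f, hf, rfl⟩
    change aeval (1 : C) f ∈ D
    rw [aeval_eq_sum_range]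
    exact sum_mem fun n _ => by rw [one_pow, smul_eq_mul, mul_one]; exact hf n
  · intro d hd
    exact ⟨Polynomial.C d, C_mem_polySubalgebra (show d ∈ D from hd), evalOne_C (A := A) d⟩

theorem expClass_mul_neg_le (hA : ∀ n : ℕ, n ≠ 0 → IsUnit (n : A)) (D : Subalgebra A C) (b : C) :
    expClass D b * expClass D (-b) ≤ D.toSubmodule := by
  rw [← expClass_zero hA, ← add_neg_cancel b]
  exact expClass_mul_le D b (-b)

theorem mul_expClass_le (hA : ∀ n : ℕ, n ≠ 0 → IsUnit (n : A)) (D : Subalgebra A C) (b : C) :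
    D.toSubmodule * expClass D b ≤ expClass D b := by
  rw [← expClass_zero hA]
  simpa using expClass_mul_le D 0 b

theorem one_mem_expClass {D : Subalgebra A C} {b : C} (hb : b ∈ D) : (1 : C) ∈ expClass D b :=
  ⟨1, one_mem_expSubmodule (C_mem_polySubalgebra hb), map_one (evalOne A C)⟩

theorem one_mem_expClass_mul (hA : ∀ n : ℕ, n ≠ 0 → IsUnit (n : A))
    (hC : subintegralClosure A C = ⊤) (b : C) :
    (1 : C) ∈ expClass (⊥ : Subalgebra A C) b * expClass ⊥ (-b) := by
  obtain ⟨D, hD, hb⟩ : b ∈ subintegralClosure A C := by rw [hC]; trivial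
  rw [expClass, expClass, ← Submodule.map_mul, C_neg]
  exact ⟨1, one_mem_expSubmodule_mul_of_isFiniteSubintegral hA hD (C_mem_polySubalgebra hb),
    map_one (evalOne A C)⟩

theorem one_add_mem_expClass {D : Subalgebra A C} {b : C} (h2 : b ^ 2 ∈ D) (h3 : b ^ 3 ∈ D) :
    1 + b ∈ expClass D b := by
  have h := one_add_C_mul_mem_expSubmodule h2 h3 (one_mem _) (X_mem_polySubalgebra D)
    derivative_X coeff_X_zero
  rw [mul_one] at h
  exact ⟨_, h, by simp [evalOne]⟩

theorem sq_mul_mem_expClass {D : Subalgebra A C} {β : C} (h2 : β ^ 2 ∈ D) (h3 : β ^ 3 ∈ D)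
    {b z : C} (hb : b ∈ D ⊔ Algebra.adjoin A {β}) (hz : z ∈ D ⊔ Algebra.adjoin A {β}) :
    β ^ 2 * z ∈ expClass D b :=
  ⟨_, C_sq_mul_mem_expSubmodule h2 h3 (C_mem_polySubalgebra hz) (C_mem_polySubalgebra hb),
    by simp [evalOne]⟩

theorem expClass_mul_neg (hA : ∀ n : ℕ, n ≠ 0 → IsUnit (n : A))
    (hC : subintegralClosure A C = ⊤) (b : C) :
    expClass (⊥ : Subalgebra A C) b * expClass ⊥ (-b) = 1 := by
  rw [← Algebra.toSubmodule_bot]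
  exact mul_eq_of_one_mem (mul_expClass_le hA _ b) (expClass_mul_neg_le hA _ b)
    (one_mem_expClass_mul hA hC b)

/-- The homomorphism `C → 𝓘(A, C)`, `b ↦ A exp(b)`, for a subintegral extension of
`ℚ`-algebras. -/
noncomputable def expHom (hA : ∀ n : ℕ, n ≠ 0 → IsUnit (n : A))
    (hC : subintegralClosure A C = ⊤) : C →+ Additive (Inv A C) :=
  AddMonoidHom.mk' (fun b => Additive.ofMul (⟨expClass ⊥ b, expClass ⊥ (-b),
      expClass_mul_neg hA hC b, by rw [mul_comm, expClass_mul_neg hA hC b]⟩ : Inv A C))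
    fun b c => by
      rw [← ofMul_mul]
      refine congrArg Additive.ofMul (Inv.eq_of_le ?_ ?_).symm
      · exact expClass_mul_le ⊥ b c
      · rw [mul_inv]
        change expClass ⊥ (-b) * expClass ⊥ (-c) ≤ expClass ⊥ (-(b + c))
        rw [neg_add]
        exact expClass_mul_le ⊥ (-b) (-c)

/-- Write `b = p + β q`. Then `1 + β q ∈ D exp(β q)` and `1` lies in both `D exp(p)` and `D
exp(-b)`; the product of the three is `1 + β q ∈ D exp(0) = D`. -/
theorem mem_of_one_mem_expClass (hA : ∀ n : ℕ, n ≠ 0 → IsUnit (n : A)) {D E : Subalgebra A C}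
    (h : IsElementarySubintegral D E) {b : C} (hb : b ∈ E) (h1 : (1 : C) ∈ expClass D (-b)) :
    b ∈ D := by
  obtain ⟨β, h2, h3, rfl⟩ := h
  obtain ⟨p, hp, q, hq, rfl⟩ := (mem_sup_adjoin_iff h2).1 hb
  have hβ2 : (β * q) ^ 2 ∈ D := by rw [mul_pow]; exact mul_mem h2 (pow_mem hq 2)
  have hβ3 : (β * q) ^ 3 ∈ D := by rw [mul_pow]; exact mul_mem h3 (pow_mem hq 3)
  have h := Submodule.mul_mem_mul (one_add_mem_expClass hβ2 hβ3)
    (Submodule.mul_mem_mul (one_mem_expClass hp) h1)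
  have h := (mul_mono_right (expClass_mul_le D _ _)).trans (expClass_mul_le D _ _) h
  rw [show β * q + (p + -(p + β * q)) = 0 by ring, expClass_zero hA, mul_one, mul_one] at h
  exact add_mem hp ((add_mem_cancel_left D.one_mem).1 h)

theorem mem_bot_of_one_mem_expClass (hA : ∀ n : ℕ, n ≠ 0 → IsUnit (n : A)) {D : Subalgebra A C}
    (hD : IsFiniteSubintegral D) {b : C} (hb : b ∈ D)
    (h1 : (1 : C) ∈ expClass (⊥ : Subalgebra A C) (-b)) : b ∈ (⊥ : Subalgebra A C) := by
  unfold IsFiniteSubintegral at hD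
  induction hD with
  | refl => exact hb
  | tail _ h ih => exact ih (mem_of_one_mem_expClass hA h hb (expClass_mono bot_le _ h1))

theorem ker_expHom (hA : ∀ n : ℕ, n ≠ 0 → IsUnit (n : A))
    (hC : subintegralClosure A C = ⊤) (b : C) :
    b ∈ (expHom hA hC).ker ↔ b ∈ (algebraMap A C).range := by
  have hbot : b ∈ (algebraMap A C).range ↔ b ∈ (⊥ : Subalgebra A C) := by
    rw [Algebra.mem_bot]; rfl
  rw [AddMonoidHom.mem_ker, hbot]
  constructor
  · intro h
    obtain ⟨D, hD, hb⟩ : b ∈ subintegralClosure A C := by rw [hC]; trivial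
    refine mem_bot_of_one_mem_expClass hA hD hb ?_
    have h : expHom hA hC (-b) = 0 := by rw [map_neg, h, neg_zero]
    have : expClass (⊥ : Subalgebra A C) (-b) = 1 := congrArg (fun z => (z.toMul : Inv A C).val) h
    rw [this]
    exact Submodule.one_le.1 le_rfl
  · intro hb
    have key : ∀ b ∈ (⊥ : Subalgebra A C), expClass (⊥ : Subalgebra A C) b ≤ 1 := by
      intro b hb z hz
      have := expClass_mul_le _ _ _ (Submodule.mul_mem_mul hz
        (one_mem_expClass (b := -b) (neg_mem hb)))
      rwa [add_neg_cancel, expClass_zero hA, mul_one, Algebra.toSubmodule_bot] at this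
    exact congrArg Additive.ofMul (Inv.eq_one_of_le (key b hb) (key (-b) (neg_mem hb)))

theorem mul_expClass_le_of_one_mem (hA : ∀ n : ℕ, n ≠ 0 → IsUnit (n : A)) {D : Subalgebra A C}
    {I J : Submodule A C} (hIJ : I * J ≤ D.toSubmodule) {b : C}
    (h : (1 : C) ∈ J * expClass D (-b)) :
    I * expClass D b ≤ D.toSubmodule := by
  refine (le_mul_of_one_le_right' (Submodule.one_le.2 h)).trans ?_
  rw [mul_mul_mul_comm]
  exact (mul_le_mul' hIJ (expClass_mul_neg_le hA D b)).trans D.isIdempotentElem_toSubmodule.le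

/-- One step of a logarithm. Replacing the factors `y i` of `∑ x i * y i = 1` by their `D`-parts
shows that `D I` contains an element `1 - β p` with `p ∈ D`, up to `β ^ 2 E`, which `D I` also
contains. So `D I` should be `D exp(-β p)`, and `b = -β p` is the exponent to remove. -/
theorem exists_expClass_mul_le (hA : ∀ n : ℕ, n ≠ 0 → IsUnit (n : A)) {D E : Subalgebra A C}
    (h : IsElementarySubintegral D E) {I J : Submodule A C} (hIJ : I * J = 1)
    (hI : I ≤ E.toSubmodule) (hJ : J ≤ E.toSubmodule) :
    ∃ b ∈ E, I * expClass D (-b) ≤ D.toSubmodule ∧ J * expClass D b ≤ D.toSubmodule := by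
  obtain ⟨β, h2, h3, rfl⟩ := h
  set E := D ⊔ Algebra.adjoin A {β} with hE
  have hDE : D ≤ E := le_sup_left
  have hβE : β ∈ E := Algebra.mem_sup_right (Algebra.self_mem_adjoin_singleton A _)
  have hcond : ∀ {z}, z ∈ E → β ^ 2 * z ∈ D := fun hz =>
    mul_mem_of_sq_of_cube h2 h3 ((mem_sup_adjoin_iff h2).1 hz)
  have hDD : D.toSubmodule * D.toSubmodule = D.toSubmodule := D.isIdempotentElem_toSubmodule
  have hD1 : (1 : Submodule A C) ≤ D.toSubmodule := Submodule.one_le.2 D.one_mem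
  obtain ⟨I', hI', hII'⟩ : ∃ I', D.toSubmodule * I = I' ∧ I ≤ I' :=
    ⟨_, rfl, le_mul_of_one_le_left' hD1⟩
  obtain ⟨J', hJ', hJJ'⟩ : ∃ J', D.toSubmodule * J = J' ∧ J ≤ J' :=
    ⟨_, rfl, le_mul_of_one_le_left' hD1⟩
  have hDI' : D.toSubmodule * I' = I' := by rw [← hI', ← mul_assoc, hDD]
  have hDJ' : D.toSubmodule * J' = J' := by rw [← hJ', ← mul_assoc, hDD]
  have hIJ' : I' * J' = D.toSubmodule := by
    rw [← hI', ← hJ', mul_mul_mul_comm, hDD, hIJ, mul_one]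
  have hmulI : ∀ {d z}, d ∈ D → z ∈ I' → d * z ∈ I' := fun hd hz =>
    hDI'.le (Submodule.mul_mem_mul hd hz)
  have hmulJ : ∀ {d z}, d ∈ D → z ∈ J' → d * z ∈ J' := fun hd hz =>
    hDJ'.le (Submodule.mul_mem_mul hd hz)
  obtain ⟨n, x, y, hx, hy, hxy⟩ := Submodule.exists_fin_sum_of_mem_mul
    (show (1 : C) ∈ I * J by rw [hIJ]; exact Submodule.one_le.1 le_rfl)
  have hxE : ∀ i, x i ∈ E := fun i => hI (hx i)
  have hyE : ∀ i, y i ∈ E := fun i => hJ (hy i)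
  have hβI : ∀ {z}, z ∈ E → β ^ 2 * z ∈ I' := fun {z} hz => by
    have : β ^ 2 * z = ∑ i, β ^ 2 * (z * y i) * x i := by
      rw [← mul_one (β ^ 2 * z), ← hxy, Finset.mul_sum]
      exact Finset.sum_congr rfl fun i _ => by ring
    rw [this]
    exact sum_mem fun i _ => hmulI (hcond (mul_mem hz (hyE i))) (hII' (hx i))
  have hβJ : ∀ {z}, z ∈ E → β ^ 2 * z ∈ J' := fun {z} hz => by
    have : β ^ 2 * z = ∑ i, β ^ 2 * (z * x i) * y i := by
      rw [← mul_one (β ^ 2 * z), ← hxy, Finset.mul_sum]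
      exact Finset.sum_congr rfl fun i _ => by ring
    rw [this]
    exact sum_mem fun i _ => hmulJ (hcond (mul_mem hz (hxE i))) (hJJ' (hy i))
  choose r hr s hs hrs using fun i => (mem_sup_adjoin_iff h2).1 (hyE i)
  choose r' hr' s' hs' hrs' using fun i => (mem_sup_adjoin_iff h2).1 (hxE i)
  have hu : ∑ i, r i * x i ∈ I' := sum_mem fun i _ => hmulI (hr i) (hII' (hx i))
  have hv : ∑ i, r' i * y i ∈ J' := sum_mem fun i _ => hmulJ (hr' i) (hJJ' (hy i))
  obtain ⟨p, hp, q, hq, hpq⟩ := (mem_sup_adjoin_iff h2).1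
    (show ∑ i, s i * x i ∈ E from sum_mem fun i _ => mul_mem (hDE (hs i)) (hxE i))
  have hwE : ∑ i, s' i * y i ∈ E := sum_mem fun i _ => mul_mem (hDE (hs' i)) (hyE i)
  have hue : ∑ i, r i * x i = 1 - β * (p + β * q) := by
    rw [← hpq, ← hxy, Finset.mul_sum, ← Finset.sum_sub_distrib]
    exact Finset.sum_congr rfl fun i _ => by rw [hrs]; ring
  have hve : ∑ i, r' i * y i = 1 - β * ∑ i, s' i * y i := by
    rw [← hxy, Finset.mul_sum, ← Finset.sum_sub_distrib]
    exact Finset.sum_congr rfl fun i _ => by rw [hrs']; ring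
  set u := ∑ i, r i * x i
  set v := ∑ i, r' i * y i
  set w := ∑ i, s' i * y i
  have hvE : v ∈ E := by rw [hve]; exact sub_mem (one_mem _) (mul_mem hβE hwE)
  have hpE := hDE hp
  have hqE := hDE hq
  have hbE : β * p ∈ E := mul_mem hβE hpE
  have hb2 : (β * p) ^ 2 ∈ D := by rw [mul_pow]; exact mul_mem h2 (pow_mem hp 2)
  have hb3 : (β * p) ^ 3 ∈ D := by rw [mul_pow]; exact mul_mem h3 (pow_mem hp 3)
  have hbI : 1 - β * p ∈ I' := by
    rw [show 1 - β * p = u + β ^ 2 * q by rw [hue]; ring]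
    exact add_mem hu (hβI hqE)
  have hpos : 1 + β * p ∈ expClass D (β * p) := one_add_mem_expClass hb2 hb3
  have hneg : 1 - β * p ∈ expClass D (-(β * p)) := by
    rw [sub_eq_add_neg]
    exact one_add_mem_expClass (by rwa [neg_sq])
      (by rw [Odd.neg_pow (by decide)]; exact neg_mem hb3)
  have hstab : ∀ {K : Submodule A C} (b : C), D.toSubmodule * K = K →
      D.toSubmodule * (K * expClass D b) ≤ K * expClass D b := fun b hK => by
    rw [← mul_assoc, hK]
  have hI1 : (1 : C) ∈ I' * expClass D (β * p) := by
    -- The element used is `(1 - β p)(1 + β p) = 1 - β (β p ^ 2)`, and the remainder `β ^ 4 w ^ 4`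
    -- splits as a product of two elements of the form `β ^ 2 z`.
    refine one_mem_of_mem_of_nilpotent (b := β) (w := β * p ^ 2) (hstab _ hDI')
      (Submodule.mul_mem_mul hbI hpos) ?_ (by ring) ?_
    · rw [show (1 - β * p) * (1 + β * p) = 1 - β ^ 2 * p ^ 2 by ring]
      exact sub_mem (one_mem _) (mul_mem h2 (pow_mem hp 2))
    · rw [show β ^ 4 * (β * p ^ 2) ^ 4 = β ^ 2 * (β * p ^ 2) ^ 4 * (β ^ 2 * 1) by ring]
      exact Submodule.mul_mem_mul (hβI (pow_mem (mul_mem hβE (pow_mem hpE 2)) 4))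
        (sq_mul_mem_expClass h2 h3 hbE (one_mem _))
  have hJ1 : (1 : C) ∈ J' * expClass D (-(β * p)) := by
    refine one_mem_of_mem_of_nilpotent (b := β) (w := w + p - β * p * w) (hstab _ hDJ')
      (Submodule.mul_mem_mul hv hneg) ?_ (by rw [hve]; ring) ?_
    · rw [show v * (1 - β * p) = u * v + β ^ 2 * (q * v) by rw [hue]; ring]
      exact add_mem (hIJ'.le (Submodule.mul_mem_mul hu hv)) (hcond (mul_mem hqE hvE))
    · rw [show β ^ 4 * (w + p - β * p * w) ^ 4 =
        β ^ 2 * (w + p - β * p * w) ^ 4 * (β ^ 2 * 1) by ring]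
      exact Submodule.mul_mem_mul
        (hβJ (pow_mem (sub_mem (add_mem hwE hpE) (mul_mem hbE hwE)) 4))
        (sq_mul_mem_expClass h2 h3 (neg_mem hbE) (one_mem _))
  refine ⟨-(β * p), neg_mem hbE, ?_, ?_⟩
  · rw [neg_neg]
    exact (mul_mono_left hII').trans (mul_expClass_le_of_one_mem hA hIJ'.le hJ1)
  · refine (mul_mono_left hJJ').trans
      (mul_expClass_le_of_one_mem hA (J := I') (by rw [mul_comm]; exact hIJ'.le) ?_)
    rwa [neg_neg]

/-- Each step of the chain is removed by multiplying with an exponential class, until the module and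
its inverse lie in `A`; the exponents add up. -/
theorem exists_eq_expClass (hA : ∀ n : ℕ, n ≠ 0 → IsUnit (n : A))
    (hC : subintegralClosure A C = ⊤) {D : Subalgebra A C} (hD : IsFiniteSubintegral D)
    {I : Inv A C} (hI : (I : Submodule A C) ≤ D.toSubmodule)
    (hI' : (↑I⁻¹ : Submodule A C) ≤ D.toSubmodule) :
    ∃ b, expHom hA hC b = Additive.ofMul I := by
  unfold IsFiniteSubintegral at hD
  induction hD generalizing I with
  | refl =>
    rw [Algebra.toSubmodule_bot] at hI hI'
    exact ⟨0, by rw [map_zero, Inv.eq_one_of_le hI hI']; rfl⟩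
  | @tail D E _ h ih =>
    obtain ⟨b, -, hb, hb'⟩ := exists_expClass_mul_le hA h I.mul_inv hI hI'
    obtain ⟨c, hc⟩ := ih (I := I * (expHom hA hC (-b)).toMul)
      ((mul_mono_right (expClass_mono bot_le _)).trans hb) (by
        rw [map_neg, toMul_neg, mul_inv, inv_inv]
        exact (mul_mono_right (expClass_mono bot_le _)).trans hb')
    refine ⟨c + b, ?_⟩
    rw [map_add, hc, ofMul_mul, ofMul_toMul, map_neg, neg_add_cancel_right]

theorem expHom_surjective (hA : ∀ n : ℕ, n ≠ 0 → IsUnit (n : A))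
    (hC : subintegralClosure A C = ⊤) : Function.Surjective (expHom hA hC) := by
  intro I
  obtain ⟨n, x, y, hx, hy, hxy⟩ := Submodule.exists_fin_sum_of_mem_mul
    (show (1 : C) ∈ (I.toMul : Submodule A C) * ↑I.toMul⁻¹ by
      rw [Units.mul_inv]; exact Submodule.one_le.1 le_rfl)
  obtain ⟨D, hD, hsD⟩ := exists_isFiniteSubintegral_of_finite (A := A)
    ((Set.finite_range x).union (Set.finite_range y)) (by rw [hC]; exact fun _ _ => trivial)
  have key : ∀ (K : Inv A C) (x y : Fin n → C), (∀ i, x i ∈ D) →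
      (∀ i, y i ∈ (↑K⁻¹ : Submodule A C)) → ∑ i, x i * y i = 1 →
      (K : Submodule A C) ≤ D.toSubmodule := by
    intro K x y hx hy hxy z hz
    have : z = ∑ i, x i * (y i * z) := by
      simp only [← mul_assoc, ← Finset.sum_mul, hxy, one_mul]
    rw [this]
    refine sum_mem fun i _ => D.mul_mem (hx i) ?_
    have := Submodule.mul_mem_mul (hy i) hz
    rw [Units.inv_mul] at this
    obtain ⟨a, ha⟩ := Submodule.mem_one.1 this
    rw [← ha]
    exact D.algebraMap_mem a
  exact exists_eq_expClass hA hC hD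
    (key _ x y (fun i => hsD (Or.inl ⟨i, rfl⟩)) hy hxy)
    (key I.toMul⁻¹ y x (fun i => hsD (Or.inr ⟨i, rfl⟩)) (by rw [inv_inv]; exact hx)
      (by rw [← hxy]; exact Finset.sum_congr rfl fun i _ => mul_comm _ _))

end Exponential

/-! ### Part (ii) for monoid algebras. -/

section MonoidAlgebra

variable {A C : Type*} [CommRing A] [CommRing C] [Algebra A C] (M : Type*) [CommMonoid M]

theorem nonempty_additive_inv_monoidAlgebra_addEquiv (hA : ∀ n : ℕ, n ≠ 0 → IsUnit (n : A))
    (hC : subintegralClosure A C = ⊤) :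
    Nonempty (Additive (Inv (MonoidAlgebra A M) (MonoidAlgebra C M)) ≃+
      MonoidAlgebra ℤ M ⊗[ℤ] Additive (Inv A C)) := by
  classical
  have hAM : ∀ n : ℕ, n ≠ 0 → IsUnit (n : MonoidAlgebra A M) := fun n hn => by
    have := (hA n hn).map (MonoidAlgebra.singleOneRingHom : A →+* MonoidAlgebra A M)
    rwa [map_natCast] at this
  let f := expHom hAM (subintegralClosure_monoidAlgebra_eq_top hC M)
  let g : MonoidAlgebra C M →+ (M →₀ Additive (Inv A C)) :=
    (Finsupp.mapRange.addMonoidHom (expHom hA hC)).comp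
      { toFun := MonoidAlgebra.coeff, map_zero' := rfl, map_add' := fun _ _ => rfl }
  have hg : Function.Surjective g := fun y => by
    obtain ⟨x, hx⟩ := Finsupp.mapRange_surjective _ (map_zero _) (expHom_surjective hA hC) y
    exact ⟨MonoidAlgebra.ofCoeff x, hx⟩
  -- Both kernels consist of the elements of `C[M]` with coefficients in `A`, so the exponential of
  -- `A[M] ⊂ C[M]` and the coefficientwise exponential of `A ⊂ C` have isomorphic images.
  have hker : f.ker = g.ker := by
    ext x
    rw [ker_expHom]
    have h₁ : x ∈ (algebraMap (MonoidAlgebra A M) (MonoidAlgebra C M)).range ↔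
        ∀ m, x.coeff m ∈ (algebraMap A C).range :=
      Set.ext_iff.1 (MonoidAlgebra.range_map (M := M) (algebraMap A C : A →+ C)) x
    rw [h₁, AddMonoidHom.mem_ker, DFunLike.ext_iff]
    exact forall_congr' fun m => (ker_expHom hA hC _).symm
  let e₁ : Additive (Inv (MonoidAlgebra A M) (MonoidAlgebra C M)) ≃+ (M →₀ Additive (Inv A C)) :=
    (QuotientAddGroup.quotientKerEquivOfSurjective f
      (expHom_surjective hAM (subintegralClosure_monoidAlgebra_eq_top hC M))).symm.trans
    ((QuotientAddGroup.quotientAddEquivOfEq hker).trans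
      (QuotientAddGroup.quotientKerEquivOfSurjective g hg))
  let e₂ : MonoidAlgebra ℤ M ⊗[ℤ] Additive (Inv A C) ≃ₗ[ℤ] (M →₀ Additive (Inv A C)) :=
    (TensorProduct.congr (MonoidAlgebra.coeffLinearEquiv ℤ) (LinearEquiv.refl ℤ _)).trans
      (TensorProduct.finsuppScalarLeft ℤ (Additive (Inv A C)) M)
  exact ⟨e₁.trans e₂.symm.toAddEquiv⟩

end MonoidAlgebra

end InvMod

open InvMod in
theorem theorem1p4 (A : Type u) (B : Type v) [CommRing A] [CommRing B] [Algebra A B]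
    (hAB : Function.Injective (algebraMap A B))
    (M : Type w) [CancelCommMonoid M] [IsMulTorsionFree M] (hM : Subsingleton Mˣ)
    (C : Subalgebra A B) (hC : C = subintegralClosure A B) :
    -- (i) the rows are exact, the two squares commute, the right vertical map is an isomorphism
    ((Function.Injective (inclMap A B C) ∧
        Function.MulExact (inclMap A B C) (extMap A B C) ∧
        Function.Surjective (extMap A B C)) ∧
      (Function.Injective (inclMapMonoid A B C M) ∧
        Function.MulExact (inclMapMonoid A B C M) (extMapMonoid A B C M) ∧
        Function.Surjective (extMapMonoid A B C M)) ∧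
      (theta A B M).comp (inclMap A B C) = (inclMapMonoid A B C M).comp (theta A C M) ∧
      (theta C B M).comp (extMap A B C) = (extMapMonoid A B C M).comp (theta A B M) ∧
      Function.Bijective (theta C B M)) ∧
    -- (ii)
    ((∃ f : ℚ →+* A, Function.Injective f) →
      Nonempty (Additive (Inv (MonoidAlgebra A M) (MonoidAlgebra C M)) ≃+
        MonoidAlgebra ℤ M ⊗[ℤ] Additive (Inv A C))) := by
  subst hC
  have htop := subintegralClosure_subintegralClosure A B
  refine ⟨⟨⟨inclMap_injective A B _, inclMap_mulExact A B _, extMap_surjective A B _ htop⟩,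
    ⟨inclMapMonoid_injective A B _ M, inclMapMonoid_mulExact A B _ M,
      extMapMonoid_surjective A B _ M htop⟩,
    theta_comp_inclMap A B _ M, theta_comp_extMap A B _ M,
    Inv.map_singleOneRingHom_bijective hM ?_⟩, ?_⟩
  -- The closure is itself subintegrally closed in `B`.
  · rintro b ⟨c, hc⟩ ⟨d, hd⟩
    exact ⟨⟨b, mem_subintegralClosure_of_sq_of_cube (hc ▸ c.2) (hd ▸ d.2)⟩, rfl⟩
  · rintro ⟨f, -⟩
    refine nonempty_additive_inv_monoidAlgebra_addEquiv M (fun n hn => ?_) htop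
    rw [← map_natCast f]
    exact (IsUnit.mk0 (n : ℚ) (Nat.cast_ne_zero.2 hn)).map f
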